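/- Let $(X,d)$ be a complete separable metric space and let $E:X\to\mathbb R\cup\{+\infty\}$ be lower semicontinuous, with dense domain $D(E)=\{E<\infty\}$, and bounded from below on every $d$-bounded set. Assume that there is $\lambda\in\mathbb R$ such that for every $z\in X$ there is an $\mathrm{EVI}_\lambda$-gradient flow of $E$ starting at $z$, i.e. a curve $\gamma:(0,\infty)\to X$, absolutely continuous on compact subintervals of $(0,\infty)$, with $\gamma_t\to z$ as $t\downarrow0$ and $$\frac12\frac{d}{dt}d^2(\gamma_t,w)+\frac\lambda2 d^2(\gamma_t,w)+E(\gamma_t)\le E(w)\qquad\text{for all } w\in X \text{ and a.e. } t>0 .$$ Let $|\partial E|(z)=\limsup_{w\to z,\,w\ne z}\frac{[E(z)-E(w)]^+}{d(z,w)}$ for $z\in D(E)$ (equal to $0$ if $z\in D(E)$ is isolated) and $|\partial E|(z)=+\infty$ for $z\notin D(E)$. For $\gamma\in C([0,1],X)$ and $\varepsilon>0$ put $$\mathcal A(\gamma)=\frac12\int_0^1|\dot\gamma_t|^2\,dt,\qquad \mathcal I(\gamma)=\frac12\int_0^1|\partial E|^2(\gamma_t)\,dt,\qquad \mathcal A_\varepsilon=\mathcal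 A+\varepsilon^2\mathcal I ,$$ where $|\dot\gamma_t|$ is the metric speed and $\mathcal A(\gamma)=+\infty$ if $\gamma$ is not absolutely continuous. Given $x,y\in X$, let $\iota_{01}(\gamma)=0$ if $\gamma_0=x$ and $\gamma_1=y$, and $\iota_{01}(\gamma)=+\infty$ otherwise. If $E(x)<\infty$ and $E(y)<\infty$, then, as $\varepsilon\downarrow0$, the functionals $\mathcal A_\varepsilon+\iota_{01}$ $\Gamma$-converge to $\mathcal A+\iota_{01}$ on $C([0,1],X)$ with respect to uniform convergence; that is: 1. for all $\varepsilon_n>0$ with $\varepsilon_n\to0$ and all $\gamma^n\to\gamma$, one has $(\mathcal A+\iota_{01})(\gamma)\le\liminf_{n\to\infty}(\mathcal A_{\varepsilon_n}+\iota_{01})(\gamma^n)$; 2. for every $\gamma\in C([0,1],X)$ there are curves $\gamma^\varepsilon\in C([0,1],X)$, $\varepsilon>0$, with $\gamma^\varepsilon\to\gamma$ as $\varepsilon\downarrow0$ and $\limsup_{\varepsilon\downarrow0}(\mathcal A_\varepsilon+\iota_{01})(\gamma^\varepsilon)\le(\mathcal A+\iota_{01})(\gamma)$. Moreover, let $\sigma$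 be any Hausdorff topology on $X$ such that every $d$-bounded sequence has a $\sigma$-convergent subsequence and such that $d:X\times X\to[0,\infty)$ and $|\partial E|:X\to[0,\infty]$ are sequentially $\sigma$-lower semicontinuous. Then the same $\Gamma$-convergence, in the sense of 1 and 2, holds on $C([0,1],X)$ with uniform convergence replaced by pointwise-in-time $\sigma$-convergence ($\gamma^n_t\to\gamma_t$ in $\sigma$ for every $t\in[0,1]$). -/

import Mathlib

open Filter Topology MeasureTheory
open scoped ENNReal

noncomputable section

namespace SchrodingerGamma

open Classical in
/-- Descending slope of `E : X → ℝ ∪ {+∞}` (values in `EReal`): `+∞` off the domain of `E`, and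
`limsup_{y → x, y ≠ x} [E x - E y]⁺ / d(x, y)` on it. `EReal.toENNReal` is the positive part. At an
isolated point the punctured neighbourhood filter is `⊥` and the `limsup` in `[0, ∞]` is `0`. -/
def metricSlope {X : Type*} [MetricSpace X] (E : X → EReal) (x : X) : ℝ≥0∞ :=
  if E x = ⊤ then ⊤
  else limsup (fun y => (E x - E y).toENNReal / edist x y) (𝓝[≠] x)

/-- `γ`, restricted to `(0, ∞)`, is an `EVI_lam` gradient flow of `E` starting at `x`: it is locally
absolutely continuous in `(0, ∞)`, satisfies for every `y` and almost every `t > 0`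
`(1/2) d/dt d²(γ_t, y) + (lam/2) d²(γ_t, y) + E(γ_t) ≤ E(y)`, and tends to `x` as `t ↓ 0`.
(The derivative exists for almost every `t > 0` by local absolute continuity.) -/
structure IsEVIFlowFrom {X : Type*} [MetricSpace X] (E : X → EReal) (lam : ℝ) (γ : ℝ → X)
    (x : X) : Prop where
  locallyAC : ∀ a b : ℝ, 0 < a → a ≤ b → AbsolutelyContinuousOnInterval γ a b
  evi : ∀ y : X, ∀ᵐ t ∂(volume.restrict (Set.Ioi (0 : ℝ))),
    ((1 / 2 * deriv (fun s => dist (γ s) y ^ 2) t + lam / 2 * dist (γ t) y ^ 2 : ℝ) : EReal)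
      + E (γ t) ≤ E y
  start : Tendsto γ (𝓝[>] 0) (𝓝 x)

/-- Completeness and separability of `X` are type class assumptions of the theorem; the remaining
assumptions on the functional `E`. Boundedness from below on bounded sets (singletons, for instance)
excludes the value `-∞`, so that `E` takes values in `ℝ ∪ {+∞}`. -/
structure IsAdmissible {X : Type*} [MetricSpace X] (E : X → EReal) : Prop where
  lsc : LowerSemicontinuous E
  dense_domain : Dense {x | E x < ⊤}
  bddBelow : ∀ B : Set X, Bornology.IsBounded B → ∃ c : ℝ, ∀ x ∈ B, (c : EReal) ≤ E x
  exists_flow : ∃ lam : ℝ, ∀ x : X, ∃ γ : ℝ → X, IsEVIFlowFrom E lam γ x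

/-- The extra hypothesis on an auxiliary topology `σ` on `X`: it is Hausdorff, bounded sets are
relatively sequentially `σ`-compact, and the distance (as a function of two variables) and the slope
of `E` are sequentially `σ`-lower semicontinuous. -/
structure IsCompatible {X : Type*} [MetricSpace X] (E : X → EReal) (σ : TopologicalSpace X) :
    Prop where
  hausdorff : @T2Space X σ
  seqCompact : ∀ u : ℕ → X, Bornology.IsBounded (Set.range u) →
    ∃ (z : X) (φ : ℕ → ℕ), StrictMono φ ∧ Tendsto (u ∘ φ) atTop (@nhds X σ z)
  dist_lsc : ∀ (u v : ℕ → X) (a b : X), Tendsto u atTop (@nhds X σ a) →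
    Tendsto v atTop (@nhds X σ b) → edist a b ≤ liminf (fun n => edist (u n) (v n)) atTop
  slope_lsc : ∀ (u : ℕ → X) (a : X), Tendsto u atTop (@nhds X σ a) →
    metricSlope E a ≤ liminf (fun n => metricSlope E (u n)) atTop

/-- Metric speed `lim_{s → t} d(γ_s, γ_t) / |s - t|`, written with a `limsup`; the limit exists for
almost every `t` when `γ` is absolutely continuous. -/
def metricSpeed {X : Type*} [MetricSpace X] (γ : ℝ → X) (t : ℝ) : ℝ≥0∞ :=
  limsup (fun s => edist (γ s) (γ t) / edist s t) (𝓝[≠] t)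

/-- The space `C([0,1], X)` of curves that are continuous for the metric topology of `X` (the name
fixes that topology also where another topology `σ` on `X` is in the context). -/
abbrev Curve (X : Type*) [MetricSpace X] : Type _ := C(unitInterval, X)

/-- A continuous curve on `[0, 1]` as a function on `ℝ` (constant to the left of `0` and to the right
of `1`). -/
def curveExtend {X : Type*} [MetricSpace X] (γ : Curve X) : ℝ → X :=
  Set.IccExtend (zero_le_one (α := ℝ)) γ

open Classical in
/-- Kinetic action `𝒜(γ) = (1/2) ∫₀¹ |γ̇_t|² dt`, and `+∞` if `γ` is not absolutely continuous. -/
def kineticAction {X : Type*} [MetricSpace X] (γ : Curve X) : ℝ≥0∞ :=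
  if AbsolutelyContinuousOnInterval (curveExtend γ) 0 1 then
    1 / 2 * ∫⁻ t in Set.Icc (0 : ℝ) 1, metricSpeed (curveExtend γ) t ^ 2
  else ⊤

/-- Halved Fisher information `ℐ(γ) = (1/2) ∫₀¹ |∂E|²(γ_t) dt`. -/
def fisherInformation {X : Type*} [MetricSpace X] (E : X → EReal) (γ : Curve X) :
    ℝ≥0∞ :=
  1 / 2 * ∫⁻ t in Set.Icc (0 : ℝ) 1, metricSlope E (curveExtend γ t) ^ 2

/-- The functional `𝒜_ε = 𝒜 + ε² ℐ`. -/
def schrodingerAction {X : Type*} [MetricSpace X] (E : X → EReal) (ε : ℝ)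
    (γ : Curve X) : ℝ≥0∞ :=
  kineticAction γ + ENNReal.ofReal (ε ^ 2) * fisherInformation E γ

open Classical in
/-- Convex indicator `ι₀₁` of the endpoint constraints `γ_0 = x`, `γ_1 = y`. -/
def endpointIndicator {X : Type*} [MetricSpace X] (x y : X) (γ : Curve X) : ℝ≥0∞ :=
  if γ 0 = x ∧ γ 1 = y then 0 else ⊤

/-- (Sequential) `Γ`-convergence of `F ε` to `G` as `ε ↓ 0` for the convergence of a topology `τ`:
the liminf inequality along all sequences `ε_n ↓ 0` and all `γ_n → γ`, and for every `γ` a recovery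
family `γ^ε → γ` as `ε ↓ 0` (which in particular is a recovery sequence along each `ε_n ↓ 0`). -/
structure GammaConverges {Y : Type*} (τ : TopologicalSpace Y) (F : ℝ → Y → ℝ≥0∞) (G : Y → ℝ≥0∞) :
    Prop where
  liminf_le : ∀ (ε : ℕ → ℝ) (γs : ℕ → Y) (γ : Y), (∀ n, 0 < ε n) → Tendsto ε atTop (𝓝 0) →
    Tendsto γs atTop (@nhds Y τ γ) → G γ ≤ liminf (fun n => F (ε n) (γs n)) atTop
  recovery : ∀ γ : Y, ∃ γs : ℝ → Y, Tendsto γs (𝓝[>] 0) (@nhds Y τ γ) ∧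
    limsup (fun ε => F ε (γs ε)) (𝓝[>] 0) ≤ G γ

/-- Topology of uniform convergence on `C([0,1], X)`; on the compact interval it is Mathlib's
topology on `C(unitInterval, X)`. -/
@[reducible]
def uniformTopology (X : Type*) [MetricSpace X] : TopologicalSpace (Curve X) :=
  inferInstance

theorem tendsto_uniformTopology_iff {X : Type*} [MetricSpace X] {ι : Type*} {l : Filter ι}
    {γs : ι → Curve X} {γ : Curve X} :
    Tendsto γs l (@nhds _ (uniformTopology X) γ) ↔ TendstoUniformly (fun i t => γs i t) γ l :=
  ContinuousMap.tendsto_iff_tendstoUniformly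

/-- Topology of pointwise-in-time `σ`-convergence on the `d`-continuous curves: the one induced from
the product topology on `[0, 1] → (X, σ)`. -/
@[reducible]
def pointwiseTopology {X : Type*} [MetricSpace X] (σ : TopologicalSpace X) :
    TopologicalSpace (Curve X) :=
  TopologicalSpace.induced (fun γ t => γ t) (@Pi.topologicalSpace unitInterval (fun _ => X) fun _ => σ)

theorem tendsto_pointwiseTopology_iff {X : Type*} [MetricSpace X] (σ : TopologicalSpace X)
    {ι : Type*} {l : Filter ι} {γs : ι → Curve X} {γ : Curve X} :
    Tendsto γs l (@nhds _ (pointwiseTopology σ) γ) ↔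
      ∀ t, Tendsto (fun i => γs i t) l (@nhds X σ (γ t)) := by
  rw [pointwiseTopology, nhds_induced, tendsto_comap_iff]
  exact @tendsto_pi_nhds ι unitInterval (fun _ => X) (fun _ => σ) _ _ _

end SchrodingerGamma

end

/-! Everything is expressed through energy bounds: monotone `w` on `[0,1]` with `d²(γ_s,γ_t) ≤
(t-s)(w_t-w_s)`. If `γ` has finite action, then `w_t = ∫₀ᵗ|γ̇|²` is one, with total increment
`2𝒜(γ)`. Conversely, any such `w` makes `γ` absolutely continuous with `|γ̇|² ≤ w'` almost
everywhere, so that `2𝒜(γ) ≤ w_1-w_0` by Lebesgue's theorem on monotone functions.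

Liminf inequality: the term `ε²ℐ` is nonnegative and is dropped. For curves of bounded action the
bounds `w` have a pointwise limit along an ultrafilter, and the displacement inequality survives it
as soon as distances are lower semicontinuous (`kineticAction_le_of_edist_le_liminf`). This covers
uniform and pointwise `σ`-convergence alike.

Recovery: evolve the curve by the flow `S`, more in the middle than near the ends, `γ^ε_t = S_{ε
min(t,1-t)} γ_t`, which keeps both endpoints. The key estimate compares flows stopped at the times
`h` and `h+δ`. Up to factors tending to `1`, it reads `d²(S_h z, S_{h+δ}z') + δ²|∂E|²(S_{h+δ}z') ≤
d²(z,z') + 2δ(E(S_h z) - E(S_{h+δ}z'))`. It follows from the EVI for `S_h z'` tested at `S_h z`,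
from contraction, and from the fact that energy is dissipated at a rate of at least about the
squared slope at the final time (`IsRegularFlow.evi_slope`, `IsRegularFlow.energy_sub_add_le`). With
`δ = ε(t-s)` the energy difference telescopes. So an explicit function, `regularizedEnergy`, is an
energy bound for `γ^ε` whose derivative also dominates `ε²|∂E|²(γ^ε_t)`.

Integrating gives `2𝒜_ε(γ^ε) ≤ (1+O(ε))·2𝒜(γ) + O(ε)(E(x)+E(y)-2E(γ^ε_{1/2}))`. The last energy is
bounded below near `γ_{1/2}`, so the upper limit is at most `𝒜(γ)`. Metric convergence implies
`σ`-convergence (`tendsto_of_isCompatible`), so the same family serves for `σ`. -/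

noncomputable section
namespace SchrodingerGamma

/-! ### Metric speed, absolute continuity and monotone majorants -/

/-- The total increment of a monotone function over disjoint intervals inside `[a, b]`. -/
theorem sum_increments_le {ι : Type*} {w : ℝ → ℝ} {a b : ℝ} (hab : a ≤ b)
    (hw : MonotoneOn w (Set.Icc a b)) (s : Finset ι) (p q : ι → ℝ)
    (hp : ∀ i ∈ s, a ≤ p i) (hpq : ∀ i ∈ s, p i ≤ q i) (hq : ∀ i ∈ s, q i ≤ b)
    (hd : (s : Set ι).PairwiseDisjoint fun i => Set.Ioc (p i) (q i)) :
    ∑ i ∈ s, (w (q i) - w (p i)) ≤ w b - w a := by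
  classical
  suffices H : ∀ c ∈ Set.Icc a b, (∀ i ∈ s, q i ≤ c) → ∑ i ∈ s, (w (q i) - w (p i)) ≤ w c - w a from
    H b ⟨hab, le_rfl⟩ hq
  clear hq
  induction s using Finset.induction_on_max_value p with
  | empty =>
    intro c hc _
    simpa using hw ⟨le_rfl, hab⟩ hc hc.1
  | insert i s his hmax ih =>
    intro c hc hqc
    have ih' := ih (fun j hj => hp j (Finset.mem_insert_of_mem hj))
      (fun j hj => hpq j (Finset.mem_insert_of_mem hj))
      (hd.subset (by simp))
    have hi := Finset.mem_insert_self i s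
    rw [Finset.sum_insert his]
    rcases (hpq i hi).eq_or_lt with h | h
    · rw [h]
      simpa using ih' c hc fun j hj => hqc j (Finset.mem_insert_of_mem hj)
    -- Interval `i` has the largest left endpoint, so every other interval must end before `p i`:
    -- otherwise both would contain `min (q i) (q j)`. Degenerate intervals, for which this fails,
    -- were split off above.
    · have h1 := ih' (p i) ⟨hp i hi, (hpq i hi).trans ((hqc i hi).trans hc.2)⟩ ?_
      · have h2 : w (q i) ≤ w c := hw ⟨(hp i hi).trans h.le, (hqc i hi).trans hc.2⟩ hc (hqc i hi)
        linarith
      · intro j hj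
        by_contra! hlt
        have hne : i ≠ j := fun h => his (h ▸ hj)
        have := hd (by simp) (by simp [hj]) hne
        refine (Set.disjoint_left.1 this) (a := min (q i) (q j)) ⟨lt_min h hlt, min_le_left _ _⟩
          ⟨lt_min ((hmax j hj).trans_lt h) ((hmax j hj).trans_lt hlt), min_le_right _ _⟩

/-- A Hölder-type bound by the increments of a monotone function implies absolute continuity. -/
theorem absolutelyContinuousOnInterval_of_sq_le {X : Type*} [MetricSpace X] {f : ℝ → X} {w : ℝ → ℝ}
    {a b : ℝ} (hab : a ≤ b) (hw : MonotoneOn w (Set.Icc a b))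
    (h : ∀ s t, a ≤ s → s ≤ t → t ≤ b → dist (f s) (f t) ^ 2 ≤ (t - s) * (w t - w s)) :
    AbsolutelyContinuousOnInterval f a b := by
  rw [absolutelyContinuousOnInterval_iff]
  intro ε hε
  -- The `+ 1` only keeps `K` positive when `w` is constant; `ε ^ 2 / K` is what Cauchy–Schwarz
  -- requires.
  set K := w b - w a + 1 with hK
  have hK0 : 0 < K := by
    have := hw ⟨le_rfl, hab⟩ ⟨hab, le_rfl⟩ hab
    linarith
  refine ⟨ε ^ 2 / K, by positivity, fun I hI hlen => ?_⟩
  obtain ⟨hI1, hI2⟩ := hI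
  rw [Set.uIcc_of_le hab] at hI1
  set p : ℕ → ℝ := fun i => min (I.2 i).1 (I.2 i).2
  set q : ℕ → ℝ := fun i => max (I.2 i).1 (I.2 i).2
  have hpq : ∀ i, p i ≤ q i := fun i => min_le_max
  have hp : ∀ i ∈ Finset.range I.1, a ≤ p i := fun i hi => le_min (hI1 i hi).1.1 (hI1 i hi).2.1
  have hq : ∀ i ∈ Finset.range I.1, q i ≤ b := fun i hi => max_le (hI1 i hi).1.2 (hI1 i hi).2.2
  have hW := sum_increments_le hab hw (Finset.range I.1) p q hp (fun i _ => hpq i) hq hI2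
  have hlen' : ∑ i ∈ Finset.range I.1, (q i - p i) < ε ^ 2 / K := by
    refine lt_of_eq_of_lt (Finset.sum_congr rfl fun i _ => ?_) hlen
    rw [Real.dist_eq, ← max_sub_min_eq_abs']
  have hmon : ∀ i ∈ Finset.range I.1, 0 ≤ w (q i) - w (p i) := fun i hi =>
    sub_nonneg.2 (hw ⟨hp i hi, (hpq i).trans (hq i hi)⟩ ⟨(hp i hi).trans (hpq i), hq i hi⟩ (hpq i))
  have hterm : ∀ i ∈ Finset.range I.1, dist (f (I.2 i).1) (f (I.2 i).2) ≤
      √(q i - p i) * √(w (q i) - w (p i)) := by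
    intro i hi
    rw [← Real.sqrt_mul (sub_nonneg.2 (hpq i))]
    refine Real.le_sqrt_of_sq_le ?_
    refine le_of_eq_of_le ?_ (h (p i) (q i) (hp i hi) (hpq i) (hq i hi))
    rcases le_total (I.2 i).1 (I.2 i).2 with h' | h'
    · simp only [p, q, min_eq_left h', max_eq_right h']
    · simp only [p, q, min_eq_right h', max_eq_left h', dist_comm]
  have hsum0 : 0 ≤ ∑ i ∈ Finset.range I.1, (q i - p i) :=
    Finset.sum_nonneg fun i _ => sub_nonneg.2 (hpq i)
  refine (Finset.sum_le_sum hterm).trans_lt ?_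
  calc ∑ i ∈ Finset.range I.1, √(q i - p i) * √(w (q i) - w (p i))
      ≤ √(∑ i ∈ Finset.range I.1, √(q i - p i) ^ 2) *
        √(∑ i ∈ Finset.range I.1, √(w (q i) - w (p i)) ^ 2) :=
        Real.sum_mul_le_sqrt_mul_sqrt _ _ _
    _ = √(∑ i ∈ Finset.range I.1, (q i - p i)) * √(∑ i ∈ Finset.range I.1, (w (q i) - w (p i))) := by
        congr 2
        · exact Finset.sum_congr rfl fun i _ => Real.sq_sqrt (sub_nonneg.2 (hpq i))
        · exact Finset.sum_congr rfl fun i hi => Real.sq_sqrt (hmon i hi)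
    _ ≤ √(∑ i ∈ Finset.range I.1, (q i - p i)) * √K := by gcongr; linarith
    _ < √(ε ^ 2 / K) * √K := by
        have := Real.sqrt_pos.2 hK0
        gcongr
    _ = ε := by rw [← Real.sqrt_mul (by positivity), div_mul_cancel₀ _ hK0.ne', Real.sqrt_sq hε.le]

/-- Functions below the derivative of a monotone function integrate to at most its increment. -/
theorem lintegral_le_of_le_deriv {w : ℝ → ℝ} {a b : ℝ} (hab : a ≤ b)
    (hw : MonotoneOn w (Set.Icc a b)) {g : ℝ → ℝ≥0∞}
    (hg : ∀ᵐ t, t ∈ Set.Ioo a b → DifferentiableAt ℝ w t → g t ≤ ENNReal.ofReal (deriv w t)) :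
    ∫⁻ t in Set.Icc a b, g t ≤ ENNReal.ofReal (w b - w a) := by
  have hw' : MonotoneOn w (Set.uIcc a b) := by rwa [Set.uIcc_of_le hab]
  have hint := hw'.intervalIntegrable_deriv
  have hmem := hw'.intervalIntegral_deriv_mem_uIcc
  rw [intervalIntegrable_iff_integrableOn_Ioo_of_le hab] at hint
  rw [Set.uIcc_of_le (sub_nonneg.2 (hw ⟨le_rfl, hab⟩ ⟨hab, le_rfl⟩ hab)),
    intervalIntegral.integral_of_le hab, integral_Ioc_eq_integral_Ioo] at hmem
  rw [setLIntegral_congr Ioo_ae_eq_Icc.symm]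
  have hnn : 0 ≤ᵐ[volume.restrict (Set.Ioo a b)] deriv w := by
    filter_upwards [ae_restrict_mem measurableSet_Ioo] with t ht
    rw [← derivWithin_of_mem_nhds (Icc_mem_nhds ht.1 ht.2)]
    exact hw.derivWithin_nonneg
  refine le_trans ?_ (ENNReal.ofReal_le_ofReal hmem.2)
  rw [ofReal_integral_eq_lintegral_ofReal hint hnn]
  refine lintegral_mono_ae ?_
  filter_upwards [ae_restrict_mem measurableSet_Ioo, ae_restrict_of_ae hg,
    ae_restrict_of_ae hw.ae_differentiableWithinAt_of_mem] with t ht h1 h2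
  exact h1 ht ((h2 (Set.Ioo_subset_Icc_self ht)).differentiableAt (Icc_mem_nhds ht.1 ht.2))

theorem edist_div_edist_eq {X : Type*} [MetricSpace X] (γ : ℝ → X) {s t : ℝ} (h : s ≠ t) :
    edist (γ s) (γ t) / edist s t = ENNReal.ofReal (dist (γ s) (γ t) / |s - t|) := by
  rw [edist_dist, edist_dist, Real.dist_eq, ENNReal.ofReal_div_of_pos (abs_pos.2 (sub_ne_zero.2 h))]

/-- Dividing by `(s - t) ^ 2` turns the hypothesis into (difference quotient of `γ`)² `≤ slope w t s
- c`; let `s → t`. The constant `c` will carry the squared slope of `E`. -/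
theorem metricSpeed_sq_add_le {X : Type*} [MetricSpace X] {γ : ℝ → X} {w : ℝ → ℝ} {t c : ℝ}
    (hc : 0 ≤ c) (hw : DifferentiableAt ℝ w t)
    (h : ∀ᶠ s in 𝓝[≠] t, dist (γ s) (γ t) ^ 2 + c * (s - t) ^ 2 ≤ (s - t) * (w s - w t)) :
    metricSpeed γ t ^ 2 + ENNReal.ofReal c ≤ ENNReal.ofReal (deriv w t) := by
  have hs : Tendsto (slope w t) (𝓝[≠] t) (𝓝 (deriv w t)) :=
    hasDerivAt_iff_tendsto_slope.1 hw.hasDerivAt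
  have hev : ∀ᶠ s in 𝓝[≠] t, (dist (γ s) (γ t) / |s - t|) ^ 2 ≤ slope w t s - c := by
    filter_upwards [h, self_mem_nhdsWithin] with s hs hne
    have h0 : s - t ≠ 0 := sub_ne_zero.2 hne
    have h2 : 0 < (s - t) ^ 2 := by positivity
    have h3 : slope w t s = (s - t) * (w s - w t) / (s - t) ^ 2 := by
      rw [slope_def_field]
      field_simp
    rw [div_pow, sq_abs, h3, le_sub_iff_add_le, div_add' _ _ _ h2.ne']
    gcongr
  have hlim : Tendsto (fun s => slope w t s - c) (𝓝[≠] t) (𝓝 (deriv w t - c)) :=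
    hs.sub tendsto_const_nhds
  have hnn : 0 ≤ deriv w t - c :=
    ge_of_tendsto hlim (hev.mono fun s hs => (sq_nonneg _).trans hs)
  have hspeed : metricSpeed γ t ≤ ENNReal.ofReal √(deriv w t - c) := by
    have hlim' : Tendsto (fun s => ENNReal.ofReal √(slope w t s - c)) (𝓝[≠] t)
        (𝓝 (ENNReal.ofReal √(deriv w t - c))) :=
      ENNReal.tendsto_ofReal ((Real.continuous_sqrt.tendsto _).comp hlim)
    rw [← hlim'.limsup_eq]
    refine limsup_le_limsup ?_
    filter_upwards [hev, self_mem_nhdsWithin] with s hs hne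
    rw [edist_div_edist_eq γ hne]
    exact ENNReal.ofReal_le_ofReal (Real.le_sqrt_of_sq_le hs)
  calc metricSpeed γ t ^ 2 + ENNReal.ofReal c
      ≤ ENNReal.ofReal √(deriv w t - c) ^ 2 + ENNReal.ofReal c := by gcongr
    _ = ENNReal.ofReal (deriv w t) := by
      rw [← ENNReal.ofReal_pow (Real.sqrt_nonneg _), Real.sq_sqrt hnn, ← ENNReal.ofReal_add hnn hc,
        sub_add_cancel]

/-- The distance from a fixed point along an absolutely continuous curve. -/
theorem absolutelyContinuousOnInterval_dist {X : Type*} [MetricSpace X] {γ : ℝ → X} {a b : ℝ}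
    (h : AbsolutelyContinuousOnInterval γ a b) (z : X) :
    AbsolutelyContinuousOnInterval (fun t => dist (γ t) z) a b := by
  refine squeeze_zero (fun I => Finset.sum_nonneg fun i _ => dist_nonneg) (fun I => ?_) h
  refine Finset.sum_le_sum fun i _ => ?_
  rw [Real.dist_eq]
  exact abs_dist_sub_le _ _ _

theorem enorm_deriv_dist_le_metricSpeed {X : Type*} [MetricSpace X] {γ : ℝ → X} {z : X} {t : ℝ}
    (h : DifferentiableAt ℝ (fun s => dist (γ s) z) t) :
    ‖deriv (fun s => dist (γ s) z) t‖ₑ ≤ metricSpeed γ t := by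
  have hs := (hasDerivAt_iff_tendsto_slope.1 h.hasDerivAt).enorm
  rw [← hs.limsup_eq]
  refine limsup_le_limsup ?_
  filter_upwards [self_mem_nhdsWithin] with s hne
  rw [edist_div_edist_eq γ hne, ← ofReal_norm, slope_def_field, norm_div]
  refine ENNReal.ofReal_le_ofReal ?_
  simp only [Real.norm_eq_abs]
  gcongr
  exact abs_dist_sub_le _ _ _

/-- Hölder estimate of the displacement by the integral of the squared metric speed. -/
theorem ofReal_dist_sq_le_lintegral {X : Type*} [MetricSpace X] {γ : ℝ → X} {s t : ℝ}
    (hst : s ≤ t) (h : AbsolutelyContinuousOnInterval γ s t) :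
    ENNReal.ofReal (dist (γ s) (γ t) ^ 2) ≤
      ENNReal.ofReal (t - s) * ∫⁻ r in Set.Ioc s t, metricSpeed γ r ^ 2 := by
  -- Hölder is applied to `|f'|`, whose measurability is available, and `|f'| ≤ |γ̇|` is inserted
  -- only afterwards; measurability of the metric speed is never needed.
  set f : ℝ → ℝ := fun r => dist (γ r) (γ s) with hf
  have hfac : AbsolutelyContinuousOnInterval f s t := absolutelyContinuousOnInterval_dist h (γ s)
  have hint := hfac.intervalIntegrable_deriv
  rw [intervalIntegrable_iff_integrableOn_Ioc_of_le hst] at hint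
  have h1 : ENNReal.ofReal (dist (γ s) (γ t)) ≤ ∫⁻ r in Set.Ioc s t, ‖deriv f r‖ₑ := by
    have := hfac.integral_deriv_eq_sub
    simp only [hf, dist_self, sub_zero] at this
    rw [dist_comm, ← this, intervalIntegral.integral_of_le hst]
    refine le_trans ?_ (enorm_integral_le_lintegral_enorm _)
    rw [← ofReal_norm]
    exact ENNReal.ofReal_le_ofReal (le_abs_self _)
  have h2 : (∫⁻ r in Set.Ioc s t, ‖deriv f r‖ₑ) ^ 2 ≤
      ENNReal.ofReal (t - s) * ∫⁻ r in Set.Ioc s t, ‖deriv f r‖ₑ ^ 2 := by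
    have hp : (2 : ℝ).HolderConjugate 2 := Real.HolderConjugate.two_two
    have := ENNReal.lintegral_mul_le_Lp_mul_Lq (volume.restrict (Set.Ioc s t)) hp
      (f := fun _ => 1) (g := fun r => ‖deriv f r‖ₑ) aemeasurable_const hint.aestronglyMeasurable.enorm
    simp only [Pi.mul_apply, one_mul, lintegral_const, Measure.restrict_apply_univ,
      Real.volume_Ioc, ENNReal.rpow_two, one_pow] at this
    calc (∫⁻ r in Set.Ioc s t, ‖deriv f r‖ₑ) ^ 2
        ≤ (ENNReal.ofReal (t - s) ^ (1 / 2 : ℝ) *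
          (∫⁻ r in Set.Ioc s t, ‖deriv f r‖ₑ ^ 2) ^ (1 / 2 : ℝ)) ^ 2 := by gcongr
      _ = _ := by
        rw [mul_pow, ← ENNReal.rpow_two, ← ENNReal.rpow_two, ← ENNReal.rpow_mul,
          ← ENNReal.rpow_mul]
        norm_num
  calc ENNReal.ofReal (dist (γ s) (γ t) ^ 2) = ENNReal.ofReal (dist (γ s) (γ t)) ^ 2 :=
        ENNReal.ofReal_pow dist_nonneg 2
    _ ≤ (∫⁻ r in Set.Ioc s t, ‖deriv f r‖ₑ) ^ 2 := by gcongr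
    _ ≤ ENNReal.ofReal (t - s) * ∫⁻ r in Set.Ioc s t, ‖deriv f r‖ₑ ^ 2 := h2
    _ ≤ ENNReal.ofReal (t - s) * ∫⁻ r in Set.Ioc s t, metricSpeed γ r ^ 2 := by
        gcongr ENNReal.ofReal (t - s) * ?_
        refine lintegral_mono_ae ?_
        filter_upwards [ae_restrict_mem measurableSet_Ioc,
          ae_restrict_of_ae hfac.ae_differentiableAt] with r hr hd
        rw [Set.uIcc_of_le hst] at hd
        have := enorm_deriv_dist_le_metricSpeed (hd (Set.Ioc_subset_Icc_self hr))
        gcongr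

/-! ### Energy bounds and lower semicontinuity of the action -/

/-- `w` controls the squared displacement of `γ` on `[0, 1]`. -/
structure IsEnergyBound {X : Type*} [MetricSpace X] (γ : ℝ → X) (w : ℝ → ℝ) : Prop where
  mono : MonotoneOn w (Set.Icc 0 1)
  sq_le : ∀ s t, 0 ≤ s → s ≤ t → t ≤ 1 → dist (γ s) (γ t) ^ 2 ≤ (t - s) * (w t - w s)

/-- Curves of finite action have an energy bound with total increment twice the action. -/
theorem exists_isEnergyBound {X : Type*} [MetricSpace X] {γ : Curve X} (h : kineticAction γ ≠ ⊤) :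
    ∃ w : ℝ → ℝ, IsEnergyBound (curveExtend γ) w ∧ w 0 = 0 ∧
      w 1 = 2 * (kineticAction γ).toReal := by
  unfold kineticAction at h ⊢
  split_ifs at h ⊢ with hac
  · set g : ℝ → ℝ≥0∞ := fun r => metricSpeed (curveExtend γ) r ^ 2
    have hfin : ∫⁻ r in Set.Icc (0 : ℝ) 1, g r ≠ ⊤ := by
      intro htop
      rw [htop, ENNReal.mul_top (by simp)] at h
      exact h rfl
    have hfin' : ∀ s t, 0 ≤ s → t ≤ 1 → ∫⁻ r in Set.Ioc s t, g r ≠ ⊤ := fun s t hs ht =>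
      ne_top_of_le_ne_top hfin (lintegral_mono_set fun r hr => ⟨hs.trans hr.1.le, hr.2.trans ht⟩)
    have hadd : ∀ s t, 0 ≤ s → s ≤ t → t ≤ 1 → (∫⁻ r in Set.Ioc 0 t, g r).toReal -
        (∫⁻ r in Set.Ioc 0 s, g r).toReal = (∫⁻ r in Set.Ioc s t, g r).toReal := by
      intro s t hs hst ht
      rw [← Set.Ioc_union_Ioc_eq_Ioc hs hst, lintegral_union measurableSet_Ioc
        (Set.Ioc_disjoint_Ioc_of_le le_rfl), ENNReal.toReal_add (hfin' _ _ le_rfl (hst.trans ht))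
        (hfin' _ _ hs ht)]
      ring
    refine ⟨fun t => (∫⁻ r in Set.Ioc 0 t, g r).toReal, ⟨fun s hs t ht hst => ?_, ?_⟩, by simp, ?_⟩
    · have := hadd s t hs.1 hst ht.2
      have : 0 ≤ (∫⁻ r in Set.Ioc s t, g r).toReal := ENNReal.toReal_nonneg
      linarith
    · intro s t hs hst ht
      rw [hadd s t hs hst ht]
      have h1 := ofReal_dist_sq_le_lintegral hst (hac.mono (c := s) (d := t) (by
        rw [Set.uIcc_of_le hst, Set.uIcc_of_le zero_le_one]
        exact Set.Icc_subset_Icc hs ht))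
      have h2 := ENNReal.toReal_mono (ENNReal.mul_ne_top ENNReal.ofReal_ne_top (hfin' s t hs ht)) h1
      rwa [ENNReal.toReal_mul, ENNReal.toReal_ofReal (sub_nonneg.2 hst),
        ENNReal.toReal_ofReal (sq_nonneg _)] at h2
    · change (∫⁻ r in Set.Ioc (0 : ℝ) 1, g r).toReal = _
      rw [setLIntegral_congr Ioc_ae_eq_Icc]
      simp
  · exact absurd rfl h

theorem IsEnergyBound.absolutelyContinuousOnInterval {X : Type*} [MetricSpace X] {γ : ℝ → X}
    {w : ℝ → ℝ} (h : IsEnergyBound γ w) : AbsolutelyContinuousOnInterval γ 0 1 :=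
  absolutelyContinuousOnInterval_of_sq_le zero_le_one h.mono h.sq_le

theorem IsEnergyBound.kineticAction_le {X : Type*} [MetricSpace X] {γ : Curve X}
    {w : ℝ → ℝ} (h : IsEnergyBound (curveExtend γ) w) :
    kineticAction γ ≤ 1 / 2 * ENNReal.ofReal (w 1 - w 0) := by
  rw [kineticAction, if_pos h.absolutelyContinuousOnInterval]
  gcongr
  refine lintegral_le_of_le_deriv zero_le_one h.mono (Eventually.of_forall fun t ht hw => ?_)
  have := metricSpeed_sq_add_le (γ := curveExtend γ) (w := w) (c := 0) le_rfl hw ?_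
  · simpa using this
  · filter_upwards [nhdsWithin_le_nhds (Ioo_mem_nhds ht.1 ht.2)] with s hs
    rcases le_total s t with hst | hst
    · nlinarith [h.sq_le s t hs.1.le hst ht.2.le]
    · rw [dist_comm]
      nlinarith [h.sq_le t s ht.1.le hst hs.2.le]

theorem curveExtend_of_mem {X : Type*} [MetricSpace X] (γ : Curve X) {t : ℝ}
    (ht : t ∈ Set.Icc (0 : ℝ) 1) : curveExtend γ t = γ ⟨t, ht⟩ :=
  Set.IccExtend_of_mem _ _ ht

/-- Sublevels of the action are closed under limits along which distances are lower
semicontinuous. -/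
theorem kineticAction_le_of_edist_le_liminf {X : Type*} [MetricSpace X] {γs : ℕ → Curve X}
    {γ : Curve X} {c : ℝ≥0∞} (hc : c ≠ ⊤) (hle : ∀ n, kineticAction (γs n) ≤ c)
    (hd : ∀ s t, edist (γ s) (γ t) ≤ liminf (fun n => edist (γs n s) (γs n t)) atTop) :
    kineticAction γ ≤ c := by
  have hfin : ∀ n, kineticAction (γs n) ≠ ⊤ := fun n => ne_top_of_le_ne_top hc (hle n)
  choose w hw hw0 hw1 using fun n => exists_isEnergyBound (hfin n)
  have hbd : ∀ n, ∀ t ∈ Set.Icc (0 : ℝ) 1, w n t ∈ Set.Icc 0 (2 * c.toReal) := by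
    intro n t ht
    have h0 := (hw n).mono ⟨le_rfl, zero_le_one⟩ ht ht.1
    have h1 := (hw n).mono ht ⟨zero_le_one, le_rfl⟩ ht.2
    have h2 := ENNReal.toReal_mono hc (hle n)
    rw [hw0] at h0
    rw [hw1] at h1
    exact ⟨h0, h1.trans (by linarith)⟩
  -- One ultrafilter gives limits of the bounded `w n t` at all times simultaneously, in place of a
  -- selection argument for monotone functions.
  have hU : ((hyperfilter ℕ : Ultrafilter ℕ) : Filter ℕ) ≤ atTop := Nat.hyperfilter_le_atTop
  have hex : ∀ t, ∃ l, t ∈ Set.Icc (0 : ℝ) 1 → l ∈ Set.Icc 0 (2 * c.toReal) ∧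
      Tendsto (fun n => w n t) (hyperfilter ℕ) (𝓝 l) := by
    intro t
    by_cases ht : t ∈ Set.Icc (0 : ℝ) 1
    · obtain ⟨l, hl, h⟩ := (isCompact_Icc (a := (0 : ℝ)) (b := 2 * c.toReal)).ultrafilter_le_nhds
        ((hyperfilter ℕ).map fun n => w n t)
        (le_principal_iff.2 (Ultrafilter.mem_map.2 (Eventually.of_forall fun n => hbd n t ht)))
      exact ⟨l, fun _ => ⟨hl, h⟩⟩
    · exact ⟨0, fun h => absurd h ht⟩
  choose W hW using hex
  have hWmono : MonotoneOn W (Set.Icc 0 1) := fun s hs t ht hst =>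
    le_of_tendsto_of_tendsto (hW s hs).2 (hW t ht).2
      (Eventually.of_forall fun n => (hw n).mono hs ht hst)
  have hWb : IsEnergyBound (curveExtend γ) W := by
    refine ⟨hWmono, fun s t hs hst ht => ?_⟩
    have hs' : s ∈ Set.Icc (0 : ℝ) 1 := ⟨hs, hst.trans ht⟩
    have ht' : t ∈ Set.Icc (0 : ℝ) 1 := ⟨hs.trans hst, ht⟩
    have hlim : Tendsto (fun n => ENNReal.ofReal √((t - s) * (w n t - w n s))) (hyperfilter ℕ)
        (𝓝 (ENNReal.ofReal √((t - s) * (W t - W s)))) :=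
      ENNReal.tendsto_ofReal ((Real.continuous_sqrt.tendsto _).comp
        (((hW t ht').2.sub (hW s hs').2).const_mul _))
    have h1 : edist (γ ⟨s, hs'⟩) (γ ⟨t, ht'⟩) ≤ ENNReal.ofReal √((t - s) * (W t - W s)) := by
      refine (hd _ _).trans ((liminf_le_liminf_of_le hU).trans ?_)
      rw [← hlim.liminf_eq]
      refine liminf_le_liminf (Eventually.of_forall fun n => ?_)
      rw [edist_dist]
      refine ENNReal.ofReal_le_ofReal (Real.le_sqrt_of_sq_le ?_)
      have := (hw n).sq_le s t hs hst ht
      rwa [curveExtend_of_mem _ hs', curveExtend_of_mem _ ht'] at this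
    rw [edist_dist, ENNReal.ofReal_le_ofReal_iff (Real.sqrt_nonneg _)] at h1
    rw [curveExtend_of_mem _ hs', curveExtend_of_mem _ ht']
    have hnn : 0 ≤ (t - s) * (W t - W s) :=
      mul_nonneg (sub_nonneg.2 hst) (sub_nonneg.2 (hWmono hs' ht' hst))
    exact (Real.le_sqrt dist_nonneg hnn).1 h1
  refine hWb.kineticAction_le.trans ?_
  have h0 := (hW 0 ⟨le_rfl, zero_le_one⟩).1.1
  have h1 := (hW 1 ⟨zero_le_one, le_rfl⟩).1.2
  calc 1 / 2 * ENNReal.ofReal (W 1 - W 0) ≤ 1 / 2 * ENNReal.ofReal (2 * c.toReal) := by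
        gcongr; linarith
    _ = c := by
        rw [ENNReal.ofReal_mul two_pos.le, ENNReal.ofReal_toReal hc, ← mul_assoc]
        simp [ENNReal.inv_mul_cancel]

/-! ### The liminf inequality -/

/-- The `liminf` inequality for any topology on curves whose convergent sequences satisfy lower
semicontinuity of distances and preserve the endpoints. -/
theorem action_le_liminf {X : Type*} [MetricSpace X] (E : X → EReal) (x y : X)
    (τ : TopologicalSpace (Curve X))
    (hdist : ∀ (γs : ℕ → Curve X) (γ : Curve X), Tendsto γs atTop (@nhds _ τ γ) →
      ∀ s t, edist (γ s) (γ t) ≤ liminf (fun n => edist (γs n s) (γs n t)) atTop)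
    (hend : ∀ (γs : ℕ → Curve X) (γ : Curve X), Tendsto γs atTop (@nhds _ τ γ) →
      ∀ (t : unitInterval) (z : X), (∀ n, γs n t = z) → γ t = z)
    (ε : ℕ → ℝ) (γs : ℕ → Curve X) (γ : Curve X) (hγ : Tendsto γs atTop (@nhds _ τ γ)) :
    kineticAction γ + endpointIndicator x y γ ≤
      liminf (fun n => schrodingerAction E (ε n) (γs n) + endpointIndicator x y (γs n)) atTop := by
  refine le_of_forall_gt fun c hc => ?_
  obtain ⟨c', hc', hcc⟩ := exists_between hc
  have hfr := frequently_lt_of_liminf_lt (by isBoundedDefault) hc'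
  -- Along this subsequence the functionals are below `c' < ⊤`, hence the endpoint constraints hold
  -- and the actions are at most `c'`.
  obtain ⟨φ, hφ, hlt⟩ := extraction_of_frequently_atTop hfr
  have hγφ := hγ.comp hφ.tendsto_atTop
  have hends : ∀ n, γs (φ n) 0 = x ∧ γs (φ n) 1 = y := by
    intro n
    by_contra h
    have := hlt n
    rw [endpointIndicator, if_neg h, add_top] at this
    exact not_top_lt this
  rw [endpointIndicator, if_pos ⟨hend _ _ hγφ 0 x fun n => (hends n).1,
    hend _ _ hγφ 1 y fun n => (hends n).2⟩, add_zero]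
  refine lt_of_le_of_lt (kineticAction_le_of_edist_le_liminf hcc.ne_top (γs := γs ∘ φ) (fun n => ?_)
    (hdist _ _ hγφ)) hcc
  exact (le_self_add.trans le_self_add).trans (hlt n).le

theorem action_le_liminf_uniform {X : Type*} [MetricSpace X] (E : X → EReal) (x y : X)
    (ε : ℕ → ℝ) (γs : ℕ → Curve X) (γ : Curve X)
    (hγ : Tendsto γs atTop (@nhds _ (uniformTopology X) γ)) :
    kineticAction γ + endpointIndicator x y γ ≤
      liminf (fun n => schrodingerAction E (ε n) (γs n) + endpointIndicator x y (γs n)) atTop := by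
  have hpt : ∀ (γs : ℕ → Curve X) (γ : Curve X),
      Tendsto γs atTop (@nhds _ (uniformTopology X) γ) → ∀ t,
      Tendsto (fun n => γs n t) atTop (𝓝 (γ t)) := fun γs γ h t =>
    (tendsto_uniformTopology_iff.1 h).tendsto_at t
  refine action_le_liminf E x y (uniformTopology X) (fun γs γ h s t => ?_) (fun γs γ h t z hz => ?_)
    ε γs γ hγ
  · exact ((hpt _ _ h s).edist (hpt _ _ h t)).liminf_eq.ge
  · exact tendsto_nhds_unique (hpt _ _ h t) (by simp [hz])

theorem action_le_liminf_pointwise {X : Type*} [MetricSpace X] (E : X → EReal) (x y : X)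
    {σ : TopologicalSpace X} (hσ : IsCompatible E σ)
    (ε : ℕ → ℝ) (γs : ℕ → Curve X) (γ : Curve X)
    (hγ : Tendsto γs atTop (@nhds _ (pointwiseTopology σ) γ)) :
    kineticAction γ + endpointIndicator x y γ ≤
      liminf (fun n => schrodingerAction E (ε n) (γs n) + endpointIndicator x y (γs n)) atTop := by
  refine action_le_liminf E x y (pointwiseTopology σ) (fun γs γ h s t => ?_)
    (fun γs γ h t z hz => ?_) ε γs γ hγ
  · rw [tendsto_pointwiseTopology_iff] at h
    exact hσ.dist_lsc _ _ _ _ (h s) (h t)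
  · rw [tendsto_pointwiseTopology_iff] at h
    have h' := h t
    simp only [hz] at h'
    exact @tendsto_nhds_unique X ℕ σ hσ.hausdorff _ atTop _ _ _ h'
      (@tendsto_const_nhds X σ ℕ z atTop)

/-! ### Metric convergence and compatible topologies -/

/-- Metric convergence implies convergence in a compatible topology. -/
theorem tendsto_of_isCompatible {X : Type*} [MetricSpace X] {E : X → EReal} {ι : Type*}
    {l : Filter ι} [l.IsCountablyGenerated] {u : ι → X} {z : X} (h : Tendsto u l (𝓝 z))
    {σ : TopologicalSpace X} (hσ : IsCompatible E σ) : Tendsto u l (@nhds X σ z) := by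
  refine tendsto_of_seq_tendsto fun ψ hψ => ?_
  -- Convergent sequences are bounded, so some further subsequence `σ`-converges; lower
  -- semicontinuity of `d(·, z)` puts its limit at distance `0` from `z`.
  refine tendsto_of_subseq_tendsto fun θ hθ => ?_
  have hu := (h.comp hψ).comp hθ
  obtain ⟨z', φ, hφ, hlim⟩ := hσ.seqCompact _ (Metric.isBounded_range_of_tendsto _ hu)
  have hz : z' = z := by
    have h1 := hσ.dist_lsc _ (fun _ => z) z' z hlim (@tendsto_const_nhds X σ ℕ z atTop)
    have h2 := (((tendsto_iff_edist_tendsto_0.1 h).comp hψ).comp hθ).comp hφ.tendsto_atTop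
    exact edist_le_zero.1 (h1.trans h2.liminf_eq.le)
  exact ⟨φ, hz ▸ hlim⟩

/-! ### EVI flows: integrated inequality and monotonicity of the energy -/

theorem IsAdmissible.ne_bot {X : Type*} [MetricSpace X] {E : X → EReal} (hE : IsAdmissible E)
    (z : X) : E z ≠ ⊥ := by
  obtain ⟨c, hc⟩ := hE.bddBelow {z} Bornology.isBounded_singleton
  exact ((EReal.bot_lt_coe c).trans_le (hc z rfl)).ne'

theorem IsAdmissible.coe_toReal {X : Type*} [MetricSpace X] {E : X → EReal} (hE : IsAdmissible E)
    {z : X} (hz : E z ≠ ⊤) : ((E z).toReal : EReal) = E z :=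
  EReal.coe_toReal hz (hE.ne_bot z)

/-- The squared distance from a point along an absolutely continuous curve. -/
theorem absolutelyContinuousOnInterval_dist_sq {X : Type*} [MetricSpace X] {γ : ℝ → X} {a b : ℝ}
    (h : AbsolutelyContinuousOnInterval γ a b) (z : X) :
    AbsolutelyContinuousOnInterval (fun t => dist (γ t) z ^ 2) a b := by
  have h1 := absolutelyContinuousOnInterval_dist h z
  have h2 := h1.mul h1
  have h3 : (fun t => dist (γ t) z ^ 2) = (fun t => dist (γ t) z) * fun t => dist (γ t) z := by
    ext t
    simp [sq]
  rwa [h3]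

theorem IsEVIFlowFrom.ae_evi {X : Type*} [MetricSpace X] {E : X → EReal} {lam : ℝ} {u : ℝ → X}
    {z : X} (hE : IsAdmissible E) (hu : IsEVIFlowFrom E lam u z) {y : X} (hy : E y ≠ ⊤) :
    ∀ᵐ t, 0 < t → E (u t) ≠ ⊤ ∧ 1 / 2 * deriv (fun s => dist (u s) y ^ 2) t
      + lam / 2 * dist (u t) y ^ 2 + (E (u t)).toReal ≤ (E y).toReal := by
  have h := hu.evi y
  rw [ae_restrict_iff' measurableSet_Ioi] at h
  filter_upwards [h] with t ht h0
  have h1 := ht h0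
  have hfin : E (u t) ≠ ⊤ := by
    intro htop
    rw [htop, EReal.coe_add_top, top_le_iff] at h1
    exact hy h1
  refine ⟨hfin, ?_⟩
  rw [← hE.coe_toReal hfin, ← hE.coe_toReal hy] at h1
  exact_mod_cast h1

theorem IsEVIFlowFrom.continuousOn_Ioi {X : Type*} [MetricSpace X] {E : X → EReal} {lam : ℝ}
    {u : ℝ → X} {z : X} (hu : IsEVIFlowFrom E lam u z) : ContinuousOn u (Set.Ioi 0) := by
  intro t ht
  have ht' : 0 < t := ht
  have h1 : AbsolutelyContinuousOnInterval u (t / 2) (t + 1) :=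
    hu.locallyAC (t / 2) (t + 1) (half_pos ht') ((half_lt_self ht').le.trans (lt_add_one t).le)
  have h2 := (absolutelyContinuousOnInterval_dist h1 (u t)).continuousOn
  rw [Set.uIcc_of_le ((half_lt_self ht').le.trans (lt_add_one t).le)] at h2
  have h3 := h2.continuousAt (Icc_mem_nhds (half_lt_self ht') (lt_add_one t))
  rw [ContinuousAt, dist_self] at h3
  exact (tendsto_iff_dist_tendsto_zero.2 h3).mono_left nhdsWithin_le_nhds

/-- The energy along the flow is squeezed between two integrable functions: a constant, since the
arc is compact and hence bounded, and the upper bound that the EVI tested at `y` provides.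
Measurability comes from lower semicontinuity. -/
theorem IsEVIFlowFrom.intervalIntegrable {X : Type*} [MetricSpace X] {E : X → EReal} {lam : ℝ}
    {u : ℝ → X} {z : X} (hE : IsAdmissible E) (hu : IsEVIFlowFrom E lam u z) {y : X} (hy : E y ≠ ⊤)
    {a b : ℝ} (ha : 0 < a) (hab : a ≤ b) :
    IntervalIntegrable (fun r => (E (u r)).toReal) volume a b := by
  have hcont : ContinuousOn u (Set.Icc a b) := hu.continuousOn_Ioi.mono fun r hr => ha.trans_le hr.1
  obtain ⟨c, hc⟩ := hE.bddBelow _ (isCompact_Icc.image_of_continuousOn hcont).isBounded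
  have hac := absolutelyContinuousOnInterval_dist_sq (hu.locallyAC a b ha hab) y
  have hint1 := hac.intervalIntegrable_deriv
  have hint2 : IntervalIntegrable (fun r => dist (u r) y ^ 2) volume a b :=
    hac.continuousOn.intervalIntegrable
  have hint : IntervalIntegrable (fun r => |c| + |(E y).toReal - (1 / 2 *
      deriv (fun s => dist (u s) y ^ 2) r + lam / 2 * dist (u r) y ^ 2)|) volume a b :=
    intervalIntegrable_const.add
      ((intervalIntegrable_const.sub ((hint1.const_mul _).add (hint2.const_mul _))).abs)
  refine hint.mono_fun ?_ ?_
  · have hmeas : Measurable fun r => E (Set.IccExtend hab ((Set.Icc a b).domRestrict u) r) :=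
      (hE.lsc.comp (continuousOn_iff_continuous_domRestrict.1 hcont).Icc_extend').measurable
    refine (hmeas.ereal_toReal.aestronglyMeasurable).congr ?_
    filter_upwards [ae_restrict_mem measurableSet_uIoc] with r hr
    rw [Set.uIoc_of_le hab] at hr
    rw [Set.IccExtend_of_mem hab _ (Set.Ioc_subset_Icc_self hr)]
    rfl
  · filter_upwards [ae_restrict_mem measurableSet_uIoc, ae_restrict_of_ae (hu.ae_evi hE hy)]
      with r hr hevi
    rw [Set.uIoc_of_le hab] at hr
    obtain ⟨hfin, hle⟩ := hevi (ha.trans hr.1)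
    have hlow : c ≤ (E (u r)).toReal := by
      have := hc (u r) ⟨r, Set.Ioc_subset_Icc_self hr, rfl⟩
      rw [← hE.coe_toReal hfin] at this
      exact_mod_cast this
    simp only [Real.norm_eq_abs]
    rw [abs_of_nonneg (a := |c| + _) (by positivity)]
    refine abs_le.2 ⟨?_, ?_⟩
    · have := neg_abs_le c
      have := abs_nonneg ((E y).toReal - (1 / 2 * deriv (fun s => dist (u s) y ^ 2) r
        + lam / 2 * dist (u r) y ^ 2))
      linarith
    · have := abs_nonneg c
      have := le_abs_self ((E y).toReal - (1 / 2 * deriv (fun s => dist (u s) y ^ 2) r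
        + lam / 2 * dist (u r) y ^ 2))
      linarith

/-- Multiplying the EVI by `exp (lam * r)` makes the two distance terms the derivative of `exp (lam
* r) / 2 * dist (u r) y ^ 2`, which is absolutely continuous. -/
theorem IsEVIFlowFrom.integral_evi {X : Type*} [MetricSpace X] {E : X → EReal} {lam : ℝ}
    {u : ℝ → X} {z : X} (hE : IsAdmissible E) (hu : IsEVIFlowFrom E lam u z) {y : X} (hy : E y ≠ ⊤)
    {s t : ℝ} (hs : 0 < s) (hst : s ≤ t) :
    Real.exp (lam * t) / 2 * dist (u t) y ^ 2 - Real.exp (lam * s) / 2 * dist (u s) y ^ 2 ≤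
      ∫ r in s..t, Real.exp (lam * r) * ((E y).toReal - (E (u r)).toReal) := by
  have hac := absolutelyContinuousOnInterval_dist_sq (hu.locallyAC s t hs hst) y
  have hder : ∀ r, HasDerivAt (fun r => Real.exp (lam * r) / 2) (lam * Real.exp (lam * r) / 2) r := by
    intro r
    exact ((((hasDerivAt_id r).const_mul lam).exp).div_const 2).congr_deriv (by simp; ring)
  have hexp : AbsolutelyContinuousOnInterval (fun r => Real.exp (lam * r) / 2) s t :=
    ContDiffOn.absolutelyContinuousOnInterval (by fun_prop)
  have h1 := hac.integral_deriv_mul_eq_sub hexp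
  have hcexp : ContinuousOn (fun r => Real.exp (lam * r)) (Set.uIcc s t) := by fun_prop
  have hint1 := hac.intervalIntegrable_deriv
  have hint2 : IntervalIntegrable (fun r => Real.exp (lam * r) * ((E y).toReal - (E (u r)).toReal))
      volume s t :=
    (intervalIntegrable_const.sub (hu.intervalIntegrable hE hy hs hst)).continuousOn_mul hcexp
  have hint3 : IntervalIntegrable (fun r => deriv (fun s => dist (u s) y ^ 2) r *
      (Real.exp (lam * r) / 2) + dist (u r) y ^ 2 * deriv (fun r => Real.exp (lam * r) / 2) r)
      volume s t := by
    refine (hint1.mul_continuousOn (by fun_prop)).add (ContinuousOn.intervalIntegrable ?_)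
    refine hac.continuousOn.mul ?_
    rw [funext fun r => (hder r).deriv]
    fun_prop
  calc _ = dist (u t) y ^ 2 * (Real.exp (lam * t) / 2) - dist (u s) y ^ 2 * (Real.exp (lam * s) / 2)
        := by ring
    _ ≤ _ := by
      rw [← h1]
      refine intervalIntegral.integral_mono_ae_restrict hst hint3 hint2 ?_
      filter_upwards [ae_restrict_mem measurableSet_Icc, ae_restrict_of_ae (hu.ae_evi hE hy)]
        with r hr hevi
      obtain ⟨-, hle⟩ := hevi (hs.trans_le hr.1)
      rw [(hder r).deriv]
      have := mul_le_mul_of_nonneg_left hle (Real.exp_pos (lam * r)).le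
      linarith

theorem intervalIntegral_exp_pos (lam : ℝ) {s t : ℝ} (h : s < t) :
    0 < ∫ r in s..t, Real.exp (lam * r) :=
  intervalIntegral.intervalIntegral_pos_of_pos
    ((by fun_prop : Continuous fun r => Real.exp (lam * r)).intervalIntegrable _ _)
    (fun _ => Real.exp_pos _) h

/-- The energy is nonincreasing along EVI flows. -/
theorem IsEVIFlowFrom.energy_le {X : Type*} [MetricSpace X] {E : X → EReal} {lam : ℝ}
    {u : ℝ → X} {z : X} (hE : IsAdmissible E) (hu : IsEVIFlowFrom E lam u z) {y : X} (hy : E y ≠ ⊤)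
    {s t : ℝ} (hs : 0 < s) (hst : s < t) : E (u t) ≤ E (u s) := by
  -- Suppose `E (u s) < c < c' < E (u t)`. The EVI tested at `u q` makes `∫ g` over `[q, r]`
  -- negative whenever `E (u q) < c`, while lower semicontinuity makes `∫ g` positive over some `[m,
  -- t]`.
  by_contra! hlt
  obtain ⟨c, hsc, hct⟩ := EReal.lt_iff_exists_real_btwn.1 hlt
  obtain ⟨c', hcc', hct'⟩ := EReal.lt_iff_exists_real_btwn.1 hct
  have hcc' : c < c' := by exact_mod_cast hcc'
  set e : ℝ → ℝ := fun r => (E (u r)).toReal with he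
  set g : ℝ → ℝ := fun r => Real.exp (lam * r) * (e r - c) with hg
  have hexpint : ∀ a b, IntervalIntegrable (fun r => Real.exp (lam * r)) volume a b := fun a b =>
    (by fun_prop : Continuous fun r => Real.exp (lam * r)).intervalIntegrable _ _
  have heint : ∀ k a b, 0 < a → a ≤ b →
      IntervalIntegrable (fun r => Real.exp (lam * r) * (e r - k)) volume a b := fun k a b ha hab =>
    ((hu.intervalIntegrable hE hy ha hab).sub intervalIntegrable_const).continuousOn_mul
      (by fun_prop)
  have hgint : ∀ a b, 0 < a → a ≤ b → IntervalIntegrable g volume a b := heint c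
  have hfin := hu.ae_evi hE hy
  have hneg : ∀ q r, 0 < q → q < r → E (u q) < c → ∫ p in q..r, g p < 0 := by
    intro q r hq hqr hqc
    have hqt : E (u q) ≠ ⊤ := hqc.ne_top
    have hqc' : e q < c := by
      rw [← hE.coe_toReal hqt] at hqc
      exact_mod_cast hqc
    have h1 := hu.integral_evi hE hqt hq hqr.le
    rw [dist_self] at h1
    have h2 : ∫ p in q..r, g p = (e q - c) * (∫ p in q..r, Real.exp (lam * p)) -
        ∫ p in q..r, Real.exp (lam * p) * ((E (u q)).toReal - (E (u p)).toReal) := by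
      rw [← intervalIntegral.integral_const_mul, ← intervalIntegral.integral_sub
        ((hexpint _ _).const_mul _)]
      · refine intervalIntegral.integral_congr fun p _ => ?_
        simp only [hg, he]
        ring
      · have := (heint (e q) q r hq hqr.le).neg
        refine this.congr fun p _ => ?_
        simp only [Pi.neg_apply, he]
        ring
    have h3 := mul_pos_of_neg_of_neg (sub_neg.2 hqc')
      (neg_neg_of_pos (intervalIntegral_exp_pos lam hqr))
    have h4 : 0 ≤ Real.exp (lam * r) / 2 * dist (u r) (u q) ^ 2 := by positivity
    rw [h2]
    linarith
  have ht0 : 0 < t := hs.trans hst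
  have hev : ∀ᶠ r in 𝓝 t, (c' : EReal) < E (u r) :=
    (hu.continuousOn_Ioi.continuousAt (Ioi_mem_nhds ht0)).eventually (hE.lsc (u t) c' hct')
  obtain ⟨m, hm, hmt⟩ : ∃ m ∈ Set.Ioo s t, ∀ r ∈ Set.Icc m t, (c' : EReal) < E (u r) := by
    obtain ⟨l, hl, hlt⟩ := exists_Ioc_subset_of_mem_nhds hev ⟨s, hst⟩
    obtain ⟨m, hm1, hm2⟩ := exists_between (max_lt hl hst)
    exact ⟨m, ⟨(le_max_right _ _).trans_lt hm1, hm2⟩, fun r hr =>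
      hlt ⟨(le_max_left _ _).trans_lt (hm1.trans_le hr.1), hr.2⟩⟩
  have hm0 : 0 < m := hs.trans hm.1
  have hpos : 0 < ∫ r in m..t, g r := by
    refine (mul_pos (sub_pos.2 hcc') (intervalIntegral_exp_pos lam hm.2)).trans_le ?_
    rw [← intervalIntegral.integral_const_mul]
    refine intervalIntegral.integral_mono_ae_restrict hm.2.le ((hexpint _ _).const_mul _)
      (hgint m t hm0 hm.2.le) ?_
    filter_upwards [ae_restrict_mem measurableSet_Icc, ae_restrict_of_ae hfin] with r hr hf
    have h1 := hmt r hr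
    rw [← hE.coe_toReal (hf (hm0.trans_le hr.1)).1] at h1
    have h2 : c' < e r := by exact_mod_cast h1
    have := Real.exp_pos (lam * r)
    simp only [hg]
    nlinarith
  set D : ℝ → ℝ := fun r => ∫ p in s..r, g p with hD
  have hDsub : ∀ a b, s ≤ a → a ≤ b → D b - D a = ∫ p in a..b, g p := fun a b ha hab =>
    intervalIntegral.integral_interval_sub_left (hgint _ _ hs (ha.trans hab)) (hgint _ _ hs ha)
  have hDcont : ContinuousOn D (Set.Icc s m) := by
    have := intervalIntegral.continuousOn_primitive_interval' (hgint s m hs hm.1.le)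
      (Set.left_mem_uIcc)
    rwa [Set.uIcc_of_le hm.1.le] at this
  have hDs : D t < D s := by
    have := hneg s t hs hst hsc
    have := hDsub s t le_rfl hst.le
    linarith
  have hDm : D m < D t := by
    have := hDsub m t hm.1.le hm.2.le
    linarith
  have hcomp : IsCompact (Set.Icc s m ∩ D ⁻¹' Set.Ici (D t)) :=
    isCompact_Icc.of_isClosed_subset (hDcont.preimage_isClosed_of_isClosed isClosed_Icc isClosed_Ici)
      Set.inter_subset_left
  -- Let `q` be the last time in `[s, m]` with `D q ≥ D t`. For `p` in `(q, m]` the integral of `g`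
  -- over `[p, t]` is positive, so `E (u p) ≥ c` and `g p ≥ 0` for almost every such `p`; then `D m
  -- ≥ D q ≥ D t`, contradicting `D m < D t`.
  obtain ⟨q, ⟨hq, hqD⟩, hqmax⟩ := hcomp.exists_isGreatest ⟨s, ⟨le_rfl, hm.1.le⟩, hDs.le⟩
  have hqD : D t ≤ D q := hqD
  have hge : 0 ≤ ∫ p in q..m, g p := by
    refine intervalIntegral.integral_nonneg_of_ae_restrict hq.2 ?_
    have hne : ∀ᵐ p, p ≠ q := by simp [ae_iff]
    filter_upwards [ae_restrict_mem measurableSet_Icc, ae_restrict_of_ae hfin,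
      ae_restrict_of_ae hne] with p hp hf hpq
    have hqp : q < p := lt_of_le_of_ne hp.1 hpq.symm
    have hsp : s ≤ p := hq.1.trans hqp.le
    have hp0 : 0 < p := hs.trans_le hsp
    have hpt : p < t := hp.2.trans_lt hm.2
    have hDp : D p < D t := by
      by_contra! hcon
      exact (hqmax ⟨⟨hsp, hp.2⟩, hcon⟩).not_gt hqp
    have hcp : (c : EReal) ≤ E (u p) := by
      by_contra! hcon
      have := hneg p t hp0 hpt hcon
      have := hDsub p t hsp hpt.le
      linarith
    rw [← hE.coe_toReal (hf hp0).1] at hcp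
    have hcp' : c ≤ e p := by exact_mod_cast hcp
    exact mul_nonneg (Real.exp_pos _).le (sub_nonneg.2 hcp')
  have := hDsub q m hq.1 hq.2
  linarith

/-! ### Flows in integrated form -/

/-- A flow in integrated form, with the initial point attached at time `0`. -/
structure IsRegularFlow {X : Type*} [MetricSpace X] (E : X → EReal) (lam : ℝ) (u : ℝ → X) :
    Prop where
  cont : ContinuousOn u (Set.Ici 0)
  ne_top : ∀ t, 0 < t → E (u t) ≠ ⊤
  energy_le : ∀ s t, 0 < s → s ≤ t → (E (u t)).toReal ≤ (E (u s)).toReal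
  evi : ∀ y, E y ≠ ⊤ → ∀ s t, 0 < s → s ≤ t →
    Real.exp (lam * t) / 2 * dist (u t) y ^ 2 - Real.exp (lam * s) / 2 * dist (u s) y ^ 2 ≤
      ∫ r in s..t, Real.exp (lam * r) * ((E y).toReal - (E (u r)).toReal)

/-- The EVI tested at a point of finite energy gives finite energy for almost every positive time,
and monotonicity extends this to every positive time. -/
theorem IsEVIFlowFrom.isRegularFlow {X : Type*} [MetricSpace X] {E : X → EReal} {lam : ℝ}
    {u : ℝ → X} {z : X} (hE : IsAdmissible E) (hu : IsEVIFlowFrom E lam u z) {y : X}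
    (hy : E y ≠ ⊤) : IsRegularFlow E lam fun t => if t ≤ 0 then z else u t := by
  have hpos : ∀ t, 0 < t → (if t ≤ 0 then z else u t) = u t := fun t ht => if_neg ht.not_ge
  have hfin : ∀ t, 0 < t → E (u t) ≠ ⊤ := by
    intro t ht
    have h1 : ∀ᵐ r ∂(volume.restrict (Set.Ioo 0 t)), E (u r) ≠ ⊤ ∧ r ∈ Set.Ioo 0 t := by
      filter_upwards [ae_restrict_mem measurableSet_Ioo, ae_restrict_of_ae (hu.ae_evi hE hy)]
        with r hr hf
      exact ⟨(hf hr.1).1, hr⟩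
    have : (ae (volume.restrict (Set.Ioo 0 t))).NeBot := by
      rw [ae_neBot, Ne, Measure.restrict_eq_zero]
      simp [ht]
    obtain ⟨r, hr, hr'⟩ := h1.exists
    exact ne_top_of_le_ne_top hr (hu.energy_le hE hy hr'.1 hr'.2)
  refine ⟨?_, fun t ht => ?_, fun s t hs hst => ?_, fun y hy s t hs hst => ?_⟩
  · intro t ht
    rcases (Set.mem_Ici.1 ht).eq_or_lt with rfl | ht
    · rw [ContinuousWithinAt, ← Set.Ioi_insert, nhdsWithin_insert, if_pos le_rfl]
      refine tendsto_sup.2 ⟨tendsto_pure_left.2 fun V hV => by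
        simpa using mem_of_mem_nhds hV, ?_⟩
      exact hu.start.congr' (eventually_nhdsWithin_of_forall fun r hr => (hpos r hr).symm)
    · refine ContinuousAt.continuousWithinAt ?_
      refine (hu.continuousOn_Ioi.continuousAt (Ioi_mem_nhds ht)).congr ?_
      filter_upwards [Ioi_mem_nhds ht] with r hr
      exact (hpos r hr).symm
  · rw [hpos t ht]
    exact hfin t ht
  · rw [hpos s hs, hpos t (hs.trans_le hst)]
    rcases hst.eq_or_lt with rfl | hst
    · exact le_rfl
    · exact EReal.toReal_le_toReal (hu.energy_le hE hy hs hst) (hE.ne_bot _) (hfin s hs)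
  · rw [hpos s hs, hpos t (hs.trans_le hst)]
    refine (hu.integral_evi hE hy hs hst).trans_eq (intervalIntegral.integral_congr fun r hr => ?_)
    rw [Set.uIcc_of_le hst] at hr
    simp only [hpos r (hs.trans_le hr.1)]

theorem IsAdmissible.exists_isRegularFlow {X : Type*} [MetricSpace X] {E : X → EReal}
    (hE : IsAdmissible E) {y : X} (hy : E y ≠ ⊤) :
    ∃ (lam : ℝ) (S : X → ℝ → X), ∀ z, S z 0 = z ∧ IsRegularFlow E lam (S z) := by
  obtain ⟨lam, h⟩ := hE.exists_flow
  choose u hu using h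
  exact ⟨lam, fun z t => if t ≤ 0 then z else u z t, fun z =>
    ⟨if_pos le_rfl, (hu z).isRegularFlow hE hy⟩⟩

/-! ### Exponential weights -/

/-- The integral of `r ↦ exp (lam * r)` over `[0, δ]`. -/
def expIntegral (lam δ : ℝ) : ℝ := ∫ r in (0 : ℝ)..δ, Real.exp (lam * r)

theorem intervalIntegrable_exp_mul (lam a b : ℝ) :
    IntervalIntegrable (fun r => Real.exp (lam * r)) volume a b :=
  (by fun_prop : Continuous fun r => Real.exp (lam * r)).intervalIntegrable _ _

theorem mul_expIntegral (lam δ : ℝ) : lam * expIntegral lam δ = Real.exp (lam * δ) - 1 := by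
  rw [expIntegral, ← intervalIntegral.integral_const_mul,
    intervalIntegral.integral_eq_sub_of_hasDerivAt (f := fun r => Real.exp (lam * r))]
  · simp
  · intro r _
    exact (((hasDerivAt_id r).const_mul lam).exp).congr_deriv (by simp; ring)
  · exact (intervalIntegrable_exp_mul lam _ _).const_mul lam

theorem integral_exp_mul_eq (lam s t : ℝ) :
    ∫ r in s..t, Real.exp (lam * r) = Real.exp (lam * s) * expIntegral lam (t - s) := by
  rw [expIntegral, ← intervalIntegral.integral_const_mul]
  have := intervalIntegral.integral_comp_add_right (a := 0) (b := t - s)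
    (fun r => Real.exp (lam * r)) s
  rw [zero_add, sub_add_cancel] at this
  rw [← this]
  refine intervalIntegral.integral_congr fun r _ => ?_
  simp only [← Real.exp_add]
  ring_nf

theorem exp_mul_le {lam r c : ℝ} (hr : 0 ≤ r) (hrc : r ≤ c) :
    Real.exp (lam * r) ≤ Real.exp (|lam| * c) := by
  refine Real.exp_le_exp.2 ?_
  have := le_abs_self lam
  have := abs_nonneg lam
  nlinarith

theorem le_exp_mul {lam r c : ℝ} (hr : 0 ≤ r) (hrc : r ≤ c) :
    Real.exp (-(|lam| * c)) ≤ Real.exp (lam * r) := by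
  refine Real.exp_le_exp.2 ?_
  have := neg_abs_le lam
  have := abs_nonneg lam
  nlinarith

theorem expIntegral_le (lam : ℝ) {δ : ℝ} (hδ : 0 ≤ δ) :
    expIntegral lam δ ≤ δ * Real.exp (|lam| * δ) := by
  have := intervalIntegral.integral_mono_on hδ (intervalIntegrable_exp_mul lam 0 δ)
    intervalIntegrable_const (g := fun _ => Real.exp (|lam| * δ)) fun r hr => exp_mul_le hr.1 hr.2
  simpa [expIntegral] using this

theorem le_expIntegral (lam : ℝ) {δ : ℝ} (hδ : 0 ≤ δ) :
    δ * Real.exp (-(|lam| * δ)) ≤ expIntegral lam δ := by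
  have := intervalIntegral.integral_mono_on hδ intervalIntegrable_const
    (intervalIntegrable_exp_mul lam 0 δ)
    (f := fun _ => Real.exp (-(|lam| * δ))) fun r hr => le_exp_mul hr.1 hr.2
  simpa [expIntegral] using this

theorem expIntegral_nonneg (lam : ℝ) {δ : ℝ} (hδ : 0 ≤ δ) : 0 ≤ expIntegral lam δ :=
  (mul_nonneg hδ (Real.exp_pos _).le).trans (le_expIntegral lam hδ)

theorem expIntegral_pos (lam : ℝ) {δ : ℝ} (hδ : 0 < δ) : 0 < expIntegral lam δ :=
  (mul_pos hδ (Real.exp_pos _)).trans_le (le_expIntegral lam hδ.le)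

/-! ### Shifts and contraction of flows -/

variable {X : Type*} [MetricSpace X] {E : X → EReal} {lam : ℝ} {u v : ℝ → X}

theorem IsRegularFlow.shift (hu : IsRegularFlow E lam u) {h : ℝ} (hh : 0 ≤ h) :
    IsRegularFlow E lam fun t => u (t + h) := by
  refine ⟨?_, fun t ht => hu.ne_top _ (by linarith), fun s t hs hst =>
    hu.energy_le _ _ (by linarith) (by linarith), fun y hy s t hs hst => ?_⟩
  · refine hu.cont.comp (by fun_prop) fun t ht => ?_
    have : 0 ≤ t := ht
    exact add_nonneg this hh
  · have h1 := hu.evi y hy (s + h) (t + h) (by linarith) (by linarith)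
    rw [← intervalIntegral.integral_comp_add_right
      (fun r => Real.exp (lam * r) * ((E y).toReal - (E (u r)).toReal))] at h1
    have h2 : ∀ r, Real.exp (lam * (r + h)) = Real.exp (lam * h) * Real.exp (lam * r) := fun r => by
      rw [← Real.exp_add]; ring_nf
    simp only [h2, mul_assoc, intervalIntegral.integral_const_mul] at h1
    refine le_of_mul_le_mul_left ?_ (Real.exp_pos (lam * h))
    refine le_trans (le_of_eq ?_) h1
    ring

theorem IsRegularFlow.intervalIntegrable (hu : IsRegularFlow E lam u) {s t : ℝ} (hs : 0 < s)
    (hst : s ≤ t) : IntervalIntegrable (fun r => (E (u r)).toReal) volume s t := by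
  refine AntitoneOn.intervalIntegrable fun a ha b _ hab => ?_
  rw [Set.uIcc_of_le hst] at ha
  exact hu.energy_le a b (hs.trans_le ha.1) hab

theorem IsRegularFlow.intervalIntegrable_exp_mul_sub (hu : IsRegularFlow E lam u) (c : ℝ) {s t : ℝ}
    (hs : 0 < s) (hst : s ≤ t) :
    IntervalIntegrable (fun r => Real.exp (lam * r) * (c - (E (u r)).toReal)) volume s t :=
  (intervalIntegrable_const.sub (hu.intervalIntegrable hs hst)).continuousOn_mul (by fun_prop)

/-- Since the energy is nonincreasing, its value at `t` may replace all earlier ones in the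
integrated EVI. -/
theorem IsRegularFlow.weak_evi (hu : IsRegularFlow E lam u) {y : X} (hy : E y ≠ ⊤) {s t : ℝ}
    (hs : 0 < s) (hst : s ≤ t) :
    Real.exp (lam * (t - s)) * dist (u t) y ^ 2 ≤ dist (u s) y ^ 2 +
      2 * expIntegral lam (t - s) * ((E y).toReal - (E (u t)).toReal) := by
  have h1 := hu.evi y hy s t hs hst
  have h2 : ∫ r in s..t, Real.exp (lam * r) * ((E y).toReal - (E (u r)).toReal) ≤
      ∫ r in s..t, Real.exp (lam * r) * ((E y).toReal - (E (u t)).toReal) := by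
    refine intervalIntegral.integral_mono_on hst (hu.intervalIntegrable_exp_mul_sub _ hs hst)
      ((intervalIntegrable_exp_mul lam s t).mul_const _) fun r hr => ?_
    have := hu.energy_le r t (hs.trans_le hr.1) hr.2
    gcongr
  rw [intervalIntegral.integral_mul_const, integral_exp_mul_eq] at h2
  have h3 : Real.exp (lam * t) = Real.exp (lam * s) * Real.exp (lam * (t - s)) := by
    rw [← Real.exp_add]; ring_nf
  rw [h3] at h1
  refine le_of_mul_le_mul_left ?_ (Real.exp_pos (lam * s))
  linarith

/-- A function whose increments are bounded by `(t - s) * (M t - M s)` is nonincreasing. -/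
theorem le_of_sub_le_mul_sub {Q M : ℝ → ℝ} {a b : ℝ} (hab : a ≤ b)
    (h : ∀ s t, a ≤ s → s ≤ t → t ≤ b → Q t - Q s ≤ (t - s) * (M t - M s)) : Q b ≤ Q a := by
  -- On a partition into `n + 1` equal steps the increments of `M` telescope, leaving a single
  -- factor equal to the mesh.
  have key : ∀ n : ℕ, Q b - Q a ≤ (b - a) * (M b - M a) * (1 / ((n : ℝ) + 1)) := by
    intro n
    have hn : (0 : ℝ) < (n : ℝ) + 1 := by positivity
    set δ := (b - a) / ((n : ℝ) + 1) with hδ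
    have hδ0 : 0 ≤ δ := div_nonneg (sub_nonneg.2 hab) hn.le
    have hδn : δ * ((n : ℝ) + 1) = b - a := div_mul_cancel₀ _ hn.ne'
    have hind : ∀ k : ℕ, k ≤ n + 1 → Q (a + k * δ) - Q a ≤ δ * (M (a + k * δ) - M a) := by
      intro k
      induction k with
      | zero => intro _; simp
      | succ k ih =>
        intro hk
        have hk' : ((k : ℝ) + 1) ≤ (n : ℝ) + 1 := by exact_mod_cast hk
        have h0 : (0 : ℝ) ≤ k * δ := by positivity
        have h1 := ih (by omega)
        have h2 := h (a + k * δ) (a + (k + 1 : ℕ) * δ) (by linarith) (by push_cast; linarith)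
          (by push_cast; nlinarith)
        have h3 : a + ((k + 1 : ℕ) : ℝ) * δ - (a + k * δ) = δ := by push_cast; ring
        rw [h3] at h2
        linarith
    have := hind (n + 1) le_rfl
    have hb : a + ((n + 1 : ℕ) : ℝ) * δ = b := by push_cast; linarith
    rw [hb] at this
    refine this.trans (le_of_eq ?_)
    rw [hδ]
    ring
  have hlim : Tendsto (fun n : ℕ => (b - a) * (M b - M a) * (1 / ((n : ℝ) + 1))) atTop
      (𝓝 ((b - a) * (M b - M a) * 0)) := tendsto_one_div_add_atTop_nhds_zero_nat.const_mul _
  rw [mul_zero] at hlim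
  have := ge_of_tendsto' hlim key
  linarith

theorem abs_exp_mul_sub_one_le {δ b : ℝ} (hδ : 0 ≤ δ) (hδb : δ ≤ b) :
    |Real.exp (lam * δ) - 1| ≤ |lam| * Real.exp (|lam| * b) * δ := by
  rw [← mul_expIntegral, abs_mul, abs_of_nonneg (expIntegral_nonneg lam hδ), mul_assoc]
  gcongr
  refine (expIntegral_le lam hδ).trans ?_
  rw [mul_comm]
  gcongr

/-- Contraction of flows at positive times. -/
theorem IsRegularFlow.exp_mul_dist_sq_le (hu : IsRegularFlow E lam u) (hv : IsRegularFlow E lam v)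
    {a b : ℝ} (ha : 0 < a) (hab : a ≤ b) :
    Real.exp (2 * (lam * b)) * dist (u b) (v b) ^ 2 ≤
      Real.exp (2 * (lam * a)) * dist (u a) (v a) ^ 2 := by
  set e : ℝ → ℝ := fun r => (E (u r)).toReal
  set f : ℝ → ℝ := fun r => (E (v r)).toReal
  set B := |f a| + |f b| + |e a| + |e b|
  set K := |lam| * Real.exp (|lam| * b)
  -- On a short step, `u` is tested at `v t` and `v` at `u s`. In the sum `f t` cancels up to a
  -- factor `exp (lam * (t - s)) - 1 = O(t - s)`, leaving the telescoping `e s - e t`; `M` collects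
  -- `-e` and the linear error `K * B * t`.
  refine le_of_sub_le_mul_sub (Q := fun t => Real.exp (2 * (lam * t)) * dist (u t) (v t) ^ 2)
    (M := fun t => 2 * Real.exp (3 * (|lam| * b)) * (K * B * t - e t)) hab fun s t hs hst ht => ?_
  have hs0 : 0 < s := ha.trans_le hs
  have ht0 : 0 < t := hs0.trans_le hst
  have hδ : 0 ≤ t - s := sub_nonneg.2 hst
  have h1 := hu.weak_evi (hv.ne_top t ht0) hs0 hst
  have h2 := hv.weak_evi (hu.ne_top s hs0) hs0 hst
  change _ ≤ _ + 2 * expIntegral lam (t - s) * (f t - e t) at h1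
  change _ ≤ _ + 2 * expIntegral lam (t - s) * (e s - f t) at h2
  rw [dist_comm (v t) (u s), dist_comm (v s) (u s)] at h2
  have hI0 := expIntegral_nonneg lam hδ
  have hI1 := expIntegral_le lam hδ
  have hI2 : expIntegral lam (t - s) ≤ (t - s) * Real.exp (|lam| * b) := by
    refine hI1.trans ?_
    gcongr
    linarith
  have hes : 0 ≤ e s - e t := sub_nonneg.2 (hu.energy_le s t hs0 hst)
  have hfe : |f t - e t| ≤ B := by
    have h3 := hu.energy_le a t ha (hs.trans hst)
    have h4 := hu.energy_le t b ht0 ht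
    have h5 := hv.energy_le a t ha (hs.trans hst)
    have h6 := hv.energy_le t b ht0 ht
    change e t ≤ e a at h3
    change e b ≤ e t at h4
    change f t ≤ f a at h5
    change f b ≤ f t at h6
    have := le_abs_self (f a)
    have := neg_abs_le (f b)
    have := le_abs_self (e a)
    have := neg_abs_le (e b)
    have := abs_nonneg (f a)
    have := abs_nonneg (f b)
    have := abs_nonneg (e a)
    have := abs_nonneg (e b)
    refine abs_le.2 ⟨?_, ?_⟩ <;> simp only [B] <;> linarith
  have hexp1 : |Real.exp (lam * (t - s)) - 1| ≤ K * (t - s) :=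
    abs_exp_mul_sub_one_le hδ (by linarith)
  have hsum : Real.exp (2 * (lam * (t - s))) * dist (u t) (v t) ^ 2 - dist (u s) (v s) ^ 2 ≤
      2 * expIntegral lam (t - s) *
        ((e s - e t) + (Real.exp (lam * (t - s)) - 1) * (f t - e t)) := by
    have h3 := mul_le_mul_of_nonneg_left h1 (Real.exp_pos (lam * (t - s))).le
    have h4 : Real.exp (2 * (lam * (t - s))) = Real.exp (lam * (t - s)) * Real.exp (lam * (t - s)) := by
      rw [← Real.exp_add]; ring_nf
    rw [h4]
    linarith
  have hterm : (Real.exp (lam * (t - s)) - 1) * (f t - e t) ≤ K * (t - s) * B := by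
    refine (le_abs_self _).trans ?_
    rw [abs_mul]
    gcongr
  have hKB : 0 ≤ K * (t - s) * B := by positivity
  have hexps : Real.exp (2 * (lam * s)) ≤ Real.exp (2 * (|lam| * b)) := by
    refine Real.exp_le_exp.2 ?_
    have := le_abs_self lam
    have := abs_nonneg lam
    nlinarith
  have hbig : 2 * expIntegral lam (t - s) *
        ((e s - e t) + (Real.exp (lam * (t - s)) - 1) * (f t - e t)) ≤
      2 * ((t - s) * Real.exp (|lam| * b)) * ((e s - e t) + K * (t - s) * B) := by
    calc _ ≤ 2 * expIntegral lam (t - s) * ((e s - e t) + K * (t - s) * B) := by gcongr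
      _ ≤ _ := by gcongr
  have h5 : Real.exp (2 * (lam * t)) = Real.exp (2 * (lam * s)) * Real.exp (2 * (lam * (t - s))) := by
    rw [← Real.exp_add]; ring_nf
  have h6 : Real.exp (3 * (|lam| * b)) = Real.exp (2 * (|lam| * b)) * Real.exp (|lam| * b) := by
    rw [← Real.exp_add]; ring_nf
  calc Real.exp (2 * (lam * t)) * dist (u t) (v t) ^ 2 -
        Real.exp (2 * (lam * s)) * dist (u s) (v s) ^ 2
      = Real.exp (2 * (lam * s)) * (Real.exp (2 * (lam * (t - s))) * dist (u t) (v t) ^ 2 -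
        dist (u s) (v s) ^ 2) := by rw [h5]; ring
    _ ≤ Real.exp (2 * (lam * s)) *
        (2 * ((t - s) * Real.exp (|lam| * b)) * ((e s - e t) + K * (t - s) * B)) := by
        gcongr
        exact hsum.trans hbig
    _ ≤ Real.exp (2 * (|lam| * b)) *
        (2 * ((t - s) * Real.exp (|lam| * b)) * ((e s - e t) + K * (t - s) * B)) := by
        gcongr
    _ = _ := by rw [h6]; ring

/-- Contraction of flows. -/
theorem IsRegularFlow.exp_mul_dist_le (hu : IsRegularFlow E lam u) (hv : IsRegularFlow E lam v)
    {a b : ℝ} (ha : 0 ≤ a) (hab : a ≤ b) :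
    Real.exp (lam * b) * dist (u b) (v b) ≤ Real.exp (lam * a) * dist (u a) (v a) := by
  have hpos : ∀ {a b : ℝ}, 0 < a → a ≤ b →
      Real.exp (lam * b) * dist (u b) (v b) ≤ Real.exp (lam * a) * dist (u a) (v a) := by
    intro a b ha hab
    have h := hu.exp_mul_dist_sq_le hv ha hab
    have h2 : ∀ r, Real.exp (2 * (lam * r)) = Real.exp (lam * r) ^ 2 := fun r => by
      rw [sq, ← Real.exp_add]; ring_nf
    rw [h2, h2, ← mul_pow, ← mul_pow] at h
    exact (pow_le_pow_iff_left₀ (by positivity) (by positivity) two_ne_zero).1 h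
  rcases ha.eq_or_lt with rfl | ha
  · rcases hab.eq_or_lt with rfl | hb
    · exact le_rfl
    have hc : ContinuousWithinAt (fun r => Real.exp (lam * r) * dist (u r) (v r)) (Set.Ici 0) 0 :=
      (by fun_prop : Continuous fun r => Real.exp (lam * r)).continuousWithinAt.mul
        ((hu.cont 0 Set.self_mem_Ici).dist (hv.cont 0 Set.self_mem_Ici))
    refine ge_of_tendsto (hc.mono_left (nhdsWithin_mono _ Set.Ioi_subset_Ici_self)) ?_
    filter_upwards [Ioc_mem_nhdsGT hb] with r hr
    exact hpos hr.1 hr.2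
  · exact hpos ha hab

/-! ### Descending slope and energy dissipation -/

/-- Some point is reached from `z` with a `lam`-corrected global descending slope larger than `q`. -/
def HasDescent {X : Type*} [MetricSpace X] (E : X → EReal) (lam : ℝ) (z : X) (q : ℝ) : Prop :=
  ∃ y, E y ≠ ⊤ ∧ 0 < dist z y ∧ ∃ c : ℝ, (c : EReal) < E z ∧
    q * dist z y < c - (E y).toReal + lam / 2 * dist z y ^ 2

/-- With the witness `y` and the level `c` kept fixed, the conditions on `z` are open, by continuity
of the distance and lower semicontinuity of `E`. The slope itself is not known to be lower
semicontinuous for the metric, and this openness takes its place. -/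
theorem HasDescent.eventually (hE : IsAdmissible E) {z : X} {q : ℝ} (h : HasDescent E lam z q) :
    ∀ᶠ z' in 𝓝 z, HasDescent E lam z' q := by
  obtain ⟨y, hy, hd, c, hc, hlt⟩ := h
  have h1 : ∀ᶠ z' in 𝓝 z, 0 < dist z' y :=
    (by fun_prop : Continuous fun z' => dist z' y).continuousAt.eventually_const_lt hd
  have h2 : ∀ᶠ z' in 𝓝 z, q * dist z' y < c - (E y).toReal + lam / 2 * dist z' y ^ 2 :=
    ContinuousAt.eventually_lt (f := fun z' => q * dist z' y)
      (g := fun z' => c - (E y).toReal + lam / 2 * dist z' y ^ 2)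
      (by fun_prop) (by fun_prop) hlt
  filter_upwards [h1, h2, hE.lsc z c hc] with z' h1 h2 h3
  exact ⟨y, hy, h1, c, h3, h2⟩

/-- A slope above `p > q` is almost realized at points `y` arbitrarily close to `z`, where the
quadratic correction is absorbed by `(p - q) * dist z y`. -/
theorem hasDescent_of_lt_metricSlope (hE : IsAdmissible E) (lam : ℝ) {z : X} (hz : E z ≠ ⊤) {q : ℝ}
    (hq : 0 ≤ q) (h : ENNReal.ofReal q < metricSlope E z) : HasDescent E lam z q := by
  rw [metricSlope, if_neg hz] at h
  obtain ⟨p, hqp, hp⟩ := ENNReal.lt_iff_exists_nnreal_btwn.1 h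
  have hqp : q < p := by
    rw [← ENNReal.ofReal_coe_nnreal] at hqp
    exact (ENNReal.ofReal_lt_ofReal_iff_of_nonneg hq).1 hqp
  have hfr := frequently_lt_of_lt_limsup (by isBoundedDefault) hp
  have hev : ∀ᶠ y in 𝓝[≠] z, -(lam / 2) * dist z y < p - q := by
    refine nhdsWithin_le_nhds ?_
    refine (by fun_prop : Continuous fun y => -(lam / 2) * dist z y).continuousAt.eventually_lt_const ?_
    simpa using hqp
  obtain ⟨y, hy, hlam, hne⟩ := (hfr.and_eventually (hev.and self_mem_nhdsWithin)).exists
  have hd : 0 < dist z y := dist_pos.2 (Ne.symm hne)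
  have hyt : E y ≠ ⊤ := by
    intro htop
    rw [htop, EReal.sub_top] at hy
    simp at hy
  rw [← hE.coe_toReal hz, ← hE.coe_toReal hyt, ← EReal.coe_sub, EReal.toENNReal_of_ne_top (EReal.coe_ne_top _),
    EReal.toReal_coe, ENNReal.lt_div_iff_mul_lt (by simp [Ne.symm hne]) (by simp [edist_ne_top]),
    edist_dist, ← ENNReal.ofReal_coe_nnreal, ← ENNReal.ofReal_mul p.coe_nonneg,
    ENNReal.ofReal_lt_ofReal_iff_of_nonneg (by positivity)] at hy
  refine ⟨y, hyt, hd, ((E z).toReal + ((E y).toReal + p * dist z y)) / 2, ?_, ?_⟩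
  · rw [← hE.coe_toReal hz]
    have : ((E z).toReal + ((E y).toReal + p * dist z y)) / 2 < (E z).toReal := by linarith
    exact_mod_cast this
  · nlinarith

/-- The initial speed of a flow is at least the descending slope. -/
theorem IsRegularFlow.eventually_mul_le_dist (hE : IsAdmissible E) (hu : IsRegularFlow E lam u)
    {δ q : ℝ} (hδ : 0 < δ) (hq : 0 ≤ q) (h : HasDescent E lam (u δ) q) :
    ∀ᶠ η in 𝓝[>] (0 : ℝ), q * η ≤ dist (u (δ + η)) (u δ) := by
  obtain ⟨y, hy, hD, c, hc, hlt⟩ := h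
  set D := dist (u δ) y
  set κ := c - (E y).toReal + lam / 2 * D ^ 2
  have hκ : 0 < κ := (mul_nonneg hq hD.le).trans_lt hlt
  have hev1 : ∀ᶠ η in 𝓝[>] (0 : ℝ), (c : EReal) < E (u (δ + η)) := by
    have h1 : ContinuousAt (fun η => u (δ + η)) 0 := by
      refine ContinuousAt.comp (f := fun η => δ + η) (g := u) ?_ (by fun_prop)
      simpa using hu.cont.continuousAt (Ici_mem_nhds hδ)
    refine nhdsWithin_le_nhds (h1.eventually (p := fun z => (c : EReal) < E z) ?_)
    simpa using hE.lsc (u δ) c hc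
  have hev2 : ∀ᶠ η in 𝓝[>] (0 : ℝ), q * D < Real.exp (-(2 * (|lam| * η))) * κ := by
    refine nhdsWithin_le_nhds ?_
    refine (by fun_prop : Continuous fun η =>
      Real.exp (-(2 * (|lam| * η))) * κ).continuousAt.eventually_const_lt ?_
    simpa using hlt
  filter_upwards [hev1, hev2, self_mem_nhdsWithin] with η h1 h2 hη
  have hη : 0 < η := hη
  have h3 := hu.weak_evi hy hδ (by linarith : δ ≤ δ + η)
  rw [add_sub_cancel_left] at h3
  have h4 : c ≤ (E (u (δ + η))).toReal := by
    rw [← hE.coe_toReal (hu.ne_top _ (by linarith))] at h1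
    exact_mod_cast h1.le
  set p := dist (u (δ + η)) (u δ)
  set d := dist (u (δ + η)) y
  have hp0 : 0 ≤ p := dist_nonneg
  have hd0 : 0 ≤ d := dist_nonneg
  have htri : D ≤ p + d := by
    have := dist_triangle (u δ) (u (δ + η)) y
    rwa [dist_comm (u δ) (u (δ + η))] at this
  -- This converts the decrease of the squared distance to `y` into the displacement `p`. Multiplied
  -- by `exp (lam * η)`, it leaves `(exp (lam * η) - 1) * D ^ 2`, which is exactly the `lam / 2`
  -- correction in `HasDescent` by `mul_expIntegral`.
  have hsq : D ^ 2 - d ^ 2 ≤ 2 * D * p := by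
    rcases le_total D p with h | h
    · nlinarith
    · nlinarith
  have hI0 := expIntegral_nonneg lam hη.le
  have hI1 := le_expIntegral lam hη.le
  have hI2 := mul_expIntegral lam η
  have h5 : expIntegral lam η * κ ≤ Real.exp (lam * η) * (D * p) := by
    have h6 := mul_le_mul_of_nonneg_left hsq (Real.exp_pos (lam * η)).le
    have h7 : expIntegral lam η * κ ≤ expIntegral lam η *
      ((E (u (δ + η))).toReal - (E y).toReal + lam / 2 * D ^ 2) := by
      simp only [κ]
      gcongr
    have h8 : expIntegral lam η * (lam / 2 * D ^ 2) = (Real.exp (lam * η) - 1) * D ^ 2 / 2 := by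
      rw [← hI2]; ring
    linarith
  have h9 : η * Real.exp (-(|lam| * η)) * κ ≤ Real.exp (|lam| * η) * (D * p) := by
    calc _ ≤ expIntegral lam η * κ := by gcongr
      _ ≤ _ := h5
      _ ≤ _ := by
        gcongr
        exact le_abs_self lam
  have h10 : η * (Real.exp (-(2 * (|lam| * η))) * κ) ≤ D * p := by
    have h11 := mul_le_mul_of_nonneg_left h9 (Real.exp_pos (-(|lam| * η))).le
    have h12 : Real.exp (-(|lam| * η)) * Real.exp (|lam| * η) = 1 := by
      rw [← Real.exp_add]; simp
    have h13 : Real.exp (-(2 * (|lam| * η))) = Real.exp (-(|lam| * η)) * Real.exp (-(|lam| * η)) := by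
      rw [← Real.exp_add]; ring_nf
    rw [h13]
    calc _ = Real.exp (-(|lam| * η)) * (η * Real.exp (-(|lam| * η)) * κ) := by ring
      _ ≤ _ := h11
      _ = (Real.exp (-(|lam| * η)) * Real.exp (|lam| * η)) * (D * p) := by ring
      _ = _ := by rw [h12, one_mul]
  refine le_of_mul_le_mul_left ?_ hD
  nlinarith

/-- Rate of energy dissipation at times where the energy is differentiable. -/
theorem IsRegularFlow.le_neg_deriv_energy (hE : IsAdmissible E) (hu : IsRegularFlow E lam u)
    {δ q : ℝ} (hq : 0 ≤ q) (h : HasDescent E lam (u δ) q) {r : ℝ} (hr : 0 < r) (hrδ : r ≤ δ)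
    (hdiff : DifferentiableAt ℝ (fun t => (E (u t)).toReal) r) :
    Real.exp (-(2 * (|lam| * δ))) * q ^ 2 ≤ -deriv (fun t => (E (u t)).toReal) r := by
  set e : ℝ → ℝ := fun t => (E (u t)).toReal with he
  have hδ : 0 < δ := hr.trans_le hrδ
  refine le_of_forall_pos_le_add fun θ hθ => ?_
  have hslope : ∀ᶠ s in 𝓝[>] r, e r - e s ≤ (-deriv e r + θ) * (s - r) := by
    have h1 : Tendsto (slope e r) (𝓝[>] r) (𝓝 (deriv e r)) :=
      (hasDerivAt_iff_tendsto_slope.1 hdiff.hasDerivAt).mono_left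
        (nhdsWithin_mono _ fun s hs => ne_of_gt hs)
    filter_upwards [h1.eventually_const_lt (sub_lt_self _ hθ), self_mem_nhdsWithin] with s hs hrs
    have hrs : 0 < s - r := sub_pos.2 hrs
    rw [slope_def_field, lt_div_iff₀ hrs] at hs
    nlinarith
  obtain ⟨b, hb, hbs⟩ := mem_nhdsGT_iff_exists_Ioc_subset.1 hslope
  have hlim : Tendsto (fun η : ℝ => Real.exp (-(2 * (|lam| * η))) *
      (Real.exp (-(2 * (|lam| * δ))) * q ^ 2)) (𝓝[>] 0)
      (𝓝 (Real.exp (-(2 * (|lam| * δ))) * q ^ 2)) := by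
    have : Continuous fun η : ℝ => Real.exp (-(2 * (|lam| * η))) *
      (Real.exp (-(2 * (|lam| * δ))) * q ^ 2) := by fun_prop
    have h0 := this.tendsto 0
    simp only [mul_zero, neg_zero, Real.exp_zero, one_mul] at h0
    exact h0.mono_left nhdsWithin_le_nhds
  refine le_of_tendsto hlim ?_
  filter_upwards [hu.eventually_mul_le_dist hE hδ hq h, Ioc_mem_nhdsGT (sub_pos.2 hb)] with η hη hη'
  have hη0 : 0 < η := hη'.1
  have hrη : r ≤ r + η := by linarith
  have h1 : Real.exp (-(|lam| * δ)) * (q * η) ≤ dist (u (r + η)) (u r) := by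
    -- Contraction between `u` and its own time shift: the displacement over a time `η` grows at
    -- most exponentially, so its lower bound at `δ` carries back to the earlier time `r`.
    have hc := (hu.shift hη0.le).exp_mul_dist_le hu hr.le hrδ
    have h2 : Real.exp (lam * r) = Real.exp (lam * δ) * Real.exp (-(lam * (δ - r))) := by
      rw [← Real.exp_add]; ring_nf
    rw [h2, mul_assoc] at hc
    have h3 := le_of_mul_le_mul_left hc (Real.exp_pos _)
    calc Real.exp (-(|lam| * δ)) * (q * η) ≤ Real.exp (-(|lam| * δ)) * dist (u (δ + η)) (u δ) := by
          gcongr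
      _ ≤ Real.exp (-(|lam| * δ)) * (Real.exp (-(lam * (δ - r))) * dist (u (r + η)) (u r)) := by
          gcongr
      _ ≤ 1 * dist (u (r + η)) (u r) := by
          rw [← mul_assoc]
          refine mul_le_mul_of_nonneg_right ?_ dist_nonneg
          rw [← Real.exp_add, Real.exp_le_one_iff]
          have h7 := neg_abs_le lam
          have h8 := abs_nonneg lam
          nlinarith
      _ = _ := one_mul _
  -- Tested at its own starting point, the EVI bounds half the squared displacement by the
  -- integrated energy loss, about `-e' η² / 2`. The halves match, so the dissipation rate is the
  -- full squared speed.
  have h2 := hu.evi (u r) (hu.ne_top r hr) r (r + η) hr hrη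
  rw [dist_self] at h2
  have hint : ∫ s in r..(r + η), Real.exp (lam * s) * (e r - e s) ≤
      ∫ s in r..(r + η), Real.exp (lam * r) * Real.exp (|lam| * η) * (-deriv e r + θ) * (s - r) := by
    refine intervalIntegral.integral_mono_on hrη (hu.intervalIntegrable_exp_mul_sub _ hr hrη)
      (Continuous.intervalIntegrable (by fun_prop) _ _) fun s hs => ?_
    rcases hs.1.eq_or_lt with rfl | hrs
    · simp
    have h3 : e r - e s ≤ (-deriv e r + θ) * (s - r) := hbs ⟨hrs, by linarith [hs.2, hη'.2]⟩
    have h4 : 0 ≤ e r - e s := sub_nonneg.2 (hu.energy_le r s hr hs.1)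
    have h5 : Real.exp (lam * s) ≤ Real.exp (lam * r) * Real.exp (|lam| * η) := by
      rw [← Real.exp_add]
      refine Real.exp_le_exp.2 ?_
      have := exp_mul_le (lam := lam) (sub_nonneg.2 hs.1) (by linarith [hs.2] : s - r ≤ η)
      have := Real.exp_le_exp.1 this
      linarith
    calc Real.exp (lam * s) * (e r - e s)
        ≤ Real.exp (lam * r) * Real.exp (|lam| * η) * (e r - e s) := by gcongr
      _ ≤ Real.exp (lam * r) * Real.exp (|lam| * η) * ((-deriv e r + θ) * (s - r)) := by gcongr
      _ = _ := by ring
  have hcalc : ∫ s in r..(r + η), (s - r) = η ^ 2 / 2 := by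
    rw [intervalIntegral.integral_comp_sub_right (fun s => s)]
    simp
  rw [intervalIntegral.integral_const_mul, hcalc] at hint
  have h3 : Real.exp (lam * (r + η)) / 2 * (Real.exp (-(|lam| * δ)) * (q * η)) ^ 2 ≤
      Real.exp (lam * r) * Real.exp (|lam| * η) * (-deriv e r + θ) * (η ^ 2 / 2) := by
    calc _ ≤ Real.exp (lam * (r + η)) / 2 * dist (u (r + η)) (u r) ^ 2 := by gcongr
      _ ≤ _ := by linarith
  have h4 : Real.exp (lam * r) * Real.exp (-(|lam| * η)) ≤ Real.exp (lam * (r + η)) := by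
    rw [← Real.exp_add]
    refine Real.exp_le_exp.2 ?_
    have := neg_abs_le lam
    nlinarith
  have h5 : Real.exp (lam * r) * Real.exp (-(|lam| * η)) / 2 * (Real.exp (-(|lam| * δ)) * (q * η)) ^ 2 ≤
      Real.exp (lam * r) * Real.exp (|lam| * η) * (-deriv e r + θ) * (η ^ 2 / 2) := by
    refine le_trans ?_ h3
    gcongr
  have hP : 0 < Real.exp (lam * r) * Real.exp (|lam| * η) * (η ^ 2 / 2) := by positivity
  refine le_of_mul_le_mul_left ?_ hP
  have h6 : Real.exp (-(|lam| * η)) = Real.exp (|lam| * η) * Real.exp (-(2 * (|lam| * η))) := by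
    rw [← Real.exp_add]; ring_nf
  have h7 : Real.exp (-(2 * (|lam| * δ))) = Real.exp (-(|lam| * δ)) ^ 2 := by
    rw [sq, ← Real.exp_add]; ring_nf
  rw [h6] at h5
  rw [h7]
  linarith

/-- Energy dissipation in terms of the descending slope at the final time. -/
theorem IsRegularFlow.mul_le_energy_sub (hE : IsAdmissible E) (hu : IsRegularFlow E lam u)
    {δ q : ℝ} (hq : 0 ≤ q) (h : q = 0 ∨ HasDescent E lam (u δ) q) {r : ℝ} (hr : 0 < r)
    (hrδ : r ≤ δ) :
    Real.exp (-(2 * (|lam| * δ))) * q ^ 2 * (δ - r) ≤ (E (u r)).toReal - (E (u δ)).toReal := by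
  rcases h with rfl | h
  · have := hu.energy_le r δ hr hrδ
    simpa using this
  set κ := Real.exp (-(2 * (|lam| * δ))) * q ^ 2
  have hκ : 0 ≤ κ := by positivity
  have hmono : MonotoneOn (fun t => -(E (u t)).toReal) (Set.Icc r δ) := fun a ha b _ hab =>
    neg_le_neg (hu.energy_le a b (hr.trans_le ha.1) hab)
  have h1 := lintegral_le_of_le_deriv hrδ hmono (g := fun _ => ENNReal.ofReal κ)
    (Eventually.of_forall fun t ht hd => by
      have hd' : DifferentiableAt ℝ (fun t => (E (u t)).toReal) t := by simpa using hd
      rw [deriv.fun_neg]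
      exact ENNReal.ofReal_le_ofReal
        (hu.le_neg_deriv_energy hE hq h (hr.trans ht.1) ht.2.le hd'))
  rw [lintegral_const, Measure.restrict_apply_univ, Real.volume_Icc, ← ENNReal.ofReal_mul hκ] at h1
  have h2 : 0 ≤ -(E (u δ)).toReal - -(E (u r)).toReal :=
    sub_nonneg.2 (hmono ⟨le_rfl, hrδ⟩ ⟨hrδ, le_rfl⟩ hrδ)
  have := (ENNReal.ofReal_le_ofReal_iff h2).1 h1
  linarith

/-- Integrated EVI with slope term. -/
theorem IsRegularFlow.evi_slope (hE : IsAdmissible E) (hu : IsRegularFlow E lam u)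
    {δ q : ℝ} (hδ : 0 < δ) (hq : 0 ≤ q) (h : q = 0 ∨ HasDescent E lam (u δ) q) {a : X}
    (ha : E a ≠ ⊤) :
    Real.exp (lam * δ) / 2 * dist (u δ) a ^ 2
      + expIntegral lam δ * ((E (u δ)).toReal - (E a).toReal)
      + Real.exp (-(3 * (|lam| * δ))) * q ^ 2 * (δ ^ 2 / 2) ≤ 1 / 2 * dist (u 0) a ^ 2 := by
  set κ := Real.exp (-(2 * (|lam| * δ))) * q ^ 2
  have hκ : 0 ≤ κ := by positivity
  -- `E (u r) ≥ E (u δ) + κ (δ - r)` is inserted into the integrated EVI from `s` to `δ`; starting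
  -- at `s > 0` avoids the possibly infinite initial energy, and then `s ↓ 0`.
  have key : ∀ s, 0 < s → s ≤ δ → Real.exp (lam * δ) / 2 * dist (u δ) a ^ 2
      + Real.exp (lam * s) * expIntegral lam (δ - s) * ((E (u δ)).toReal - (E a).toReal)
      + Real.exp (-(|lam| * δ)) * κ * ((δ - s) ^ 2 / 2) ≤
        Real.exp (lam * s) / 2 * dist (u s) a ^ 2 := by
    intro s hs hsδ
    have h1 := hu.evi a ha s δ hs hsδ
    have h2 : ∫ r in s..δ, Real.exp (lam * r) * ((E a).toReal - (E (u r)).toReal) ≤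
        ∫ r in s..δ, (Real.exp (lam * r) * ((E a).toReal - (E (u δ)).toReal) -
          Real.exp (-(|lam| * δ)) * κ * (δ - r)) := by
      refine intervalIntegral.integral_mono_on hsδ (hu.intervalIntegrable_exp_mul_sub _ hs hsδ)
        (Continuous.intervalIntegrable (by fun_prop) _ _) fun r hr => ?_
      have hr0 : 0 < r := hs.trans_le hr.1
      have h3 := hu.mul_le_energy_sub hE hq h hr0 hr.2
      have h4 := le_exp_mul (lam := lam) hr0.le hr.2
      have h5 : Real.exp (-(|lam| * δ)) * (κ * (δ - r)) ≤
          Real.exp (lam * r) * ((E (u r)).toReal - (E (u δ)).toReal) :=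
        mul_le_mul h4 h3 (mul_nonneg hκ (sub_nonneg.2 hr.2)) (Real.exp_pos _).le
      linarith
    have hcalc : ∫ r in s..δ, (δ - r) = (δ - s) ^ 2 / 2 := by
      rw [intervalIntegral.integral_comp_sub_left (fun r => r)]
      simp
    rw [intervalIntegral.integral_sub (Continuous.intervalIntegrable (by fun_prop) _ _)
      (Continuous.intervalIntegrable (by fun_prop) _ _), intervalIntegral.integral_mul_const,
      intervalIntegral.integral_const_mul, hcalc, integral_exp_mul_eq] at h2
    linarith
  have hI : Continuous (expIntegral lam) :=
    intervalIntegral.continuous_primitive (intervalIntegrable_exp_mul lam) 0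
  have hR : Tendsto (fun s => Real.exp (lam * s) / 2 * dist (u s) a ^ 2) (𝓝[>] 0)
      (𝓝 (Real.exp (lam * 0) / 2 * dist (u 0) a ^ 2)) := by
    have h0 : Tendsto u (𝓝[>] 0) (𝓝 (u 0)) :=
      (hu.cont 0 Set.self_mem_Ici).mono_left (nhdsWithin_mono _ Set.Ioi_subset_Ici_self)
    refine Tendsto.mul ?_ ((h0.dist tendsto_const_nhds).pow 2)
    exact ((by fun_prop : Continuous fun s => Real.exp (lam * s) / 2).tendsto 0).mono_left
      nhdsWithin_le_nhds
  have hL : Tendsto (fun s => Real.exp (lam * δ) / 2 * dist (u δ) a ^ 2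
      + Real.exp (lam * s) * expIntegral lam (δ - s) * ((E (u δ)).toReal - (E a).toReal)
      + Real.exp (-(|lam| * δ)) * κ * ((δ - s) ^ 2 / 2)) (𝓝[>] 0)
      (𝓝 (Real.exp (lam * δ) / 2 * dist (u δ) a ^ 2
      + Real.exp (lam * 0) * expIntegral lam (δ - 0) * ((E (u δ)).toReal - (E a).toReal)
      + Real.exp (-(|lam| * δ)) * κ * ((δ - 0) ^ 2 / 2))) :=
    ((by fun_prop : Continuous fun s => Real.exp (lam * δ) / 2 * dist (u δ) a ^ 2
      + Real.exp (lam * s) * expIntegral lam (δ - s) * ((E (u δ)).toReal - (E a).toReal)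
      + Real.exp (-(|lam| * δ)) * κ * ((δ - s) ^ 2 / 2)).tendsto 0).mono_left nhdsWithin_le_nhds
  have hfinal := le_of_tendsto_of_tendsto hL hR (by
    filter_upwards [Ioc_mem_nhdsGT hδ] with s hs
    exact key s hs.1 hs.2)
  simp only [mul_zero, Real.exp_zero, one_mul, sub_zero] at hfinal
  have h3 : Real.exp (-(3 * (|lam| * δ))) = Real.exp (-(|lam| * δ)) * Real.exp (-(2 * (|lam| * δ))) := by
    rw [← Real.exp_add]; ring_nf
  rw [h3]
  simp only [κ] at hfinal
  linarith

theorem IsRegularFlow.dist_le (hu : IsRegularFlow E lam u) (hv : IsRegularFlow E lam v) {h : ℝ}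
    (hh : 0 ≤ h) : dist (u h) (v h) ≤ Real.exp (|lam| * h) * dist (u 0) (v 0) := by
  have h2 := hu.exp_mul_dist_le hv le_rfl hh
  rw [mul_zero, Real.exp_zero, one_mul] at h2
  have h4 := le_exp_mul (lam := lam) hh le_rfl
  have h5 : Real.exp (|lam| * h) * Real.exp (-(|lam| * h)) = 1 := by rw [← Real.exp_add]; simp
  calc dist (u h) (v h) = Real.exp (|lam| * h) * (Real.exp (-(|lam| * h)) * dist (u h) (v h)) := by
        rw [← mul_assoc, h5, one_mul]
    _ ≤ Real.exp (|lam| * h) * (Real.exp (lam * h) * dist (u h) (v h)) := by gcongr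
    _ ≤ _ := by gcongr

/-- Comparison of the states of two flows, started at `u 0` and `v 0`, at times `h < h + δ`. -/
theorem IsRegularFlow.energy_sub_add_le (hE : IsAdmissible E) (hu : IsRegularFlow E lam u)
    (hv : IsRegularFlow E lam v) {h δ q : ℝ} (hh : 0 ≤ h) (hδ : 0 < δ) (hq : 0 ≤ q)
    (hdesc : q = 0 ∨ HasDescent E lam (v (h + δ)) q) (hfin : E (u h) ≠ ⊤) :
    (E (v (h + δ))).toReal - (E (u h)).toReal + Real.exp (-(4 * (|lam| * (h + δ)))) *
        ((dist (u h) (v (h + δ)) ^ 2 + q ^ 2 * δ ^ 2) / (2 * δ)) ≤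
      Real.exp (2 * (|lam| * (h + δ))) * (dist (u 0) (v 0) ^ 2 / (2 * δ)) := by
  -- The flow restarted at `v h` is tested at `u h`; contraction then replaces `dist (u h) (v h)` by
  -- the initial distance.
  have h1 := (hv.shift hh).evi_slope hE hδ hq (by rwa [add_comm δ h]) hfin
  rw [zero_add, add_comm δ h, dist_comm _ (u h), dist_comm _ (u h)] at h1
  set ell := |lam|
  have hell : 0 ≤ ell := abs_nonneg lam
  set e := (E (v (h + δ))).toReal - (E (u h)).toReal
  set d := dist (u h) (v (h + δ))
  set I := expIntegral lam δ
  have hI : 0 < I := expIntegral_pos lam hδ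
  have hI1 : δ * Real.exp (-(ell * δ)) ≤ I := le_expIntegral lam hδ.le
  have hI2 : I ≤ δ * Real.exp (ell * δ) := expIntegral_le lam hδ.le
  have hcon : dist (u h) (v h) ^ 2 ≤ Real.exp (2 * (ell * h)) * dist (u 0) (v 0) ^ 2 := by
    have h3 := hu.dist_le hv hh
    have h6 : Real.exp (2 * (ell * h)) = Real.exp (ell * h) ^ 2 := by
      rw [sq, ← Real.exp_add]; ring_nf
    rw [h6, ← mul_pow]
    gcongr
  have hdiv : e + (Real.exp (lam * δ) / 2 * d ^ 2 +
      Real.exp (-(3 * (ell * δ))) * q ^ 2 * (δ ^ 2 / 2)) / I ≤ (1 / 2 * dist (u h) (v h) ^ 2) / I := by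
    rw [← le_sub_iff_add_le, ← sub_div, le_div_iff₀ hI]
    linarith
  have hup : (1 / 2 * dist (u h) (v h) ^ 2) / I ≤
      Real.exp (2 * (ell * (h + δ))) * (dist (u 0) (v 0) ^ 2 / (2 * δ)) := by
    rw [div_le_iff₀ hI]
    have h7 : Real.exp (2 * (ell * (h + δ))) * (dist (u 0) (v 0) ^ 2 / (2 * δ)) *
        (δ * Real.exp (-(ell * δ))) ≤
        Real.exp (2 * (ell * (h + δ))) * (dist (u 0) (v 0) ^ 2 / (2 * δ)) * I := by
      gcongr
    refine le_trans ?_ h7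
    have h8 : Real.exp (2 * (ell * h)) ≤ Real.exp (2 * (ell * (h + δ))) * Real.exp (-(ell * δ)) := by
      rw [← Real.exp_add]
      refine Real.exp_le_exp.2 ?_
      nlinarith
    calc 1 / 2 * dist (u h) (v h) ^ 2 ≤ 1 / 2 * (Real.exp (2 * (ell * h)) * dist (u 0) (v 0) ^ 2) := by
          gcongr
      _ ≤ 1 / 2 * (Real.exp (2 * (ell * (h + δ))) * Real.exp (-(ell * δ)) * dist (u 0) (v 0) ^ 2) := by
          gcongr
      _ = _ := by field_simp
  have hlow : Real.exp (-(4 * (ell * (h + δ)))) * ((d ^ 2 + q ^ 2 * δ ^ 2) / (2 * δ)) ≤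
      (Real.exp (lam * δ) / 2 * d ^ 2 + Real.exp (-(3 * (ell * δ))) * q ^ 2 * (δ ^ 2 / 2)) / I := by
    rw [le_div_iff₀ hI]
    have h9 : Real.exp (-(4 * (ell * (h + δ)))) * Real.exp (ell * δ) ≤ Real.exp (-(3 * (ell * δ))) := by
      rw [← Real.exp_add]
      refine Real.exp_le_exp.2 ?_
      nlinarith [mul_nonneg hell hh]
    have h10 : Real.exp (-(3 * (ell * δ))) ≤ Real.exp (lam * δ) := by
      refine le_trans (Real.exp_le_exp.2 ?_) (le_exp_mul (lam := lam) hδ.le le_rfl)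
      nlinarith [mul_nonneg hell hδ.le]
    calc _ ≤ Real.exp (-(4 * (ell * (h + δ)))) * ((d ^ 2 + q ^ 2 * δ ^ 2) / (2 * δ)) *
          (δ * Real.exp (ell * δ)) := by gcongr
      _ = (Real.exp (-(4 * (ell * (h + δ)))) * Real.exp (ell * δ)) * ((d ^ 2 + q ^ 2 * δ ^ 2) / 2) := by
          field_simp
      _ ≤ Real.exp (-(3 * (ell * δ))) * ((d ^ 2 + q ^ 2 * δ ^ 2) / 2) := by gcongr
      _ = Real.exp (-(3 * (ell * δ))) / 2 * d ^ 2 +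
          Real.exp (-(3 * (ell * δ))) * q ^ 2 * (δ ^ 2 / 2) := by ring
      _ ≤ _ := by gcongr
  linarith

/-! ### The regularized curve and its energy bound -/

variable {S : X → ℝ → X}

/-- Joint continuity of a family of flows in time and initial point. -/
theorem continuous_flow (hS : ∀ z, S z 0 = z ∧ IsRegularFlow E lam (S z)) {Y : Type*}
    [TopologicalSpace Y] {f : Y → X} {h : Y → ℝ} (hf : Continuous f) (hh : Continuous h)
    (h0 : ∀ y, 0 ≤ h y) : Continuous fun y => S (f y) (h y) := by
  rw [continuous_iff_continuousAt]
  intro y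
  have h1 : Tendsto (fun y' => S (f y) (h y')) (𝓝 y) (𝓝 (S (f y) (h y))) :=
    ((hS (f y)).2.cont (h y) (h0 y)).tendsto.comp
      (tendsto_nhdsWithin_iff.2 ⟨hh.tendsto y, Eventually.of_forall h0⟩)
  have h2 : Tendsto (fun y' => Real.exp (|lam| * h y') * dist (f y') (f y) +
      dist (S (f y) (h y')) (S (f y) (h y))) (𝓝 y) (𝓝 0) := by
    have h3 : Tendsto (fun y' => Real.exp (|lam| * h y') * dist (f y') (f y)) (𝓝 y) (𝓝 0) := by
      have := (by fun_prop : Continuous fun y' =>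
        Real.exp (|lam| * h y') * dist (f y') (f y)).tendsto y
      simpa using this
    simpa using h3.add (tendsto_iff_dist_tendsto_zero.1 h1)
  refine tendsto_iff_dist_tendsto_zero.2 (squeeze_zero (fun _ => dist_nonneg) (fun y' => ?_) h2)
  refine (dist_triangle _ (S (f y) (h y')) _).trans (add_le_add_left ?_ _)
  have := (hS (f y')).2.dist_le (hS (f y)).2 (h0 y')
  rwa [(hS (f y')).1, (hS (f y)).1] at this

/-- Comparison of two points evolved for times differing by `ε * Δ`. -/
theorem dist_flow_sq_add_le (hE : IsAdmissible E)
    (hS : ∀ z, S z 0 = z ∧ IsRegularFlow E lam (S z)) {z z' : X} {ε h Δ K q : ℝ} (hε : 0 < ε)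
    (hh : 0 ≤ h) (hΔ : 0 ≤ Δ) (hle : h + ε * Δ ≤ ε) (hd : dist z z' ^ 2 ≤ Δ * K)
    (hq : 0 ≤ q) (hdesc : q = 0 ∨ HasDescent E lam (S z' (h + ε * Δ)) q) (hfin : E (S z h) ≠ ⊤) :
    dist (S z h) (S z' (h + ε * Δ)) ^ 2 + ε ^ 2 * q ^ 2 * Δ ^ 2 ≤
      Δ * (Real.exp (4 * (|lam| * ε)) * (Real.exp (2 * (|lam| * ε)) * K +
        2 * ε * ((E (S z h)).toReal - (E (S z' (h + ε * Δ))).toReal))) := by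
  -- For `Δ = 0` the hypothesis forces `z = z'`; the general comparison divides by `ε * Δ`.
  rcases hΔ.eq_or_lt with rfl | hΔ
  · have hzz : z = z' := by
      rw [zero_mul] at hd
      exact dist_eq_zero.1 (pow_eq_zero_iff two_ne_zero |>.1 (le_antisymm hd (sq_nonneg _)))
    simp [hzz]
  have h1 := (hS z).2.energy_sub_add_le hE (hS z').2 hh (mul_pos hε hΔ) hq hdesc hfin
  rw [(hS z).1, (hS z').1] at h1
  set e := (E (S z' (h + ε * Δ))).toReal - (E (S z h)).toReal
  set d := dist (S z h) (S z' (h + ε * Δ))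
  have hlam := abs_nonneg lam
  have h2 : Real.exp (-(4 * (|lam| * ε))) ≤ Real.exp (-(4 * (|lam| * (h + ε * Δ)))) := by gcongr
  have h3 : Real.exp (2 * (|lam| * (h + ε * Δ))) ≤ Real.exp (2 * (|lam| * ε)) := by gcongr
  have h4 : e + Real.exp (-(4 * (|lam| * ε))) * ((d ^ 2 + q ^ 2 * (ε * Δ) ^ 2) / (2 * (ε * Δ))) ≤
      Real.exp (2 * (|lam| * ε)) * (K / (2 * ε)) := by
    calc _ ≤ e + Real.exp (-(4 * (|lam| * (h + ε * Δ)))) *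
          ((d ^ 2 + q ^ 2 * (ε * Δ) ^ 2) / (2 * (ε * Δ))) := by gcongr
      _ ≤ _ := h1
      _ ≤ Real.exp (2 * (|lam| * ε)) * (Δ * K / (2 * (ε * Δ))) := by gcongr
      _ = _ := by
        congr 1
        field_simp
  have h5 : Real.exp (4 * (|lam| * ε)) * Real.exp (-(4 * (|lam| * ε))) = 1 := by
    rw [← Real.exp_add]; simp
  have h6 : (d ^ 2 + q ^ 2 * (ε * Δ) ^ 2) / (2 * (ε * Δ)) ≤
      Real.exp (4 * (|lam| * ε)) * (Real.exp (2 * (|lam| * ε)) * (K / (2 * ε)) - e) := by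
    calc _ = Real.exp (4 * (|lam| * ε)) * (Real.exp (-(4 * (|lam| * ε))) *
          ((d ^ 2 + q ^ 2 * (ε * Δ) ^ 2) / (2 * (ε * Δ)))) := by
          rw [← mul_assoc (Real.exp _) (Real.exp _), h5, one_mul]
      _ ≤ _ := by gcongr; linarith
  rw [div_le_iff₀ (by positivity)] at h6
  calc d ^ 2 + ε ^ 2 * q ^ 2 * Δ ^ 2 = d ^ 2 + q ^ 2 * (ε * Δ) ^ 2 := by ring
    _ ≤ _ := h6
    _ = Δ * (Real.exp (4 * (|lam| * ε)) * (Real.exp (2 * (|lam| * ε)) * (K / (2 * ε) * (2 * ε)) +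
        2 * ε * -e)) := by ring
    _ = _ := by
      rw [div_mul_cancel₀ _ (by positivity)]
      simp only [e, neg_sub]

/-- The curve `γ`, each point of which is evolved by the flow for the time `ε * min t (1 - t)`
(for `ε ≥ 0`), as a continuous family in `ε`. -/
def regularizedCurve (hS : ∀ z, S z 0 = z ∧ IsRegularFlow E lam (S z)) (γ : Curve X) :
    C(ℝ, Curve X) :=
  ContinuousMap.curry ⟨fun p : ℝ × unitInterval =>
    S (γ p.2) (max p.1 0 * min (p.2 : ℝ) (1 - p.2)), continuous_flow hS (by fun_prop) (by fun_prop)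
      fun p => mul_nonneg (le_max_right _ _) (le_min p.2.2.1 (sub_nonneg.2 p.2.2.2))⟩

theorem regularizedCurve_zero (hS : ∀ z, S z 0 = z ∧ IsRegularFlow E lam (S z)) (γ : Curve X) :
    regularizedCurve hS γ 0 = γ := by
  ext t
  simp [regularizedCurve, (hS _).1]

theorem curveExtend_regularizedCurve (hS : ∀ z, S z 0 = z ∧ IsRegularFlow E lam (S z)) (γ : Curve X)
    {ε : ℝ} (hε : 0 < ε) {t : ℝ} (ht : t ∈ Set.Icc (0 : ℝ) 1) :
    curveExtend (regularizedCurve hS γ ε) t = S (curveExtend γ t) (ε * min t (1 - t)) := by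
  rw [curveExtend_of_mem _ ht, curveExtend_of_mem _ ht]
  simp [regularizedCurve, max_eq_left hε.le]

theorem continuous_curveExtend (γ : Curve X) : Continuous (curveExtend γ) :=
  γ.continuous.Icc_extend'

/-- `(√(a A) + √(b B))² ≤ (a + b) (A + B)`, for the distances of three points. -/
theorem dist_sq_le_of_dist_sq_le {p q r : X} {a b A B : ℝ} (ha : 0 ≤ a) (hb : 0 ≤ b) (hA : 0 ≤ A)
    (hB : 0 ≤ B) (h1 : dist p q ^ 2 ≤ a * A) (h2 : dist q r ^ 2 ≤ b * B) :
    dist p r ^ 2 ≤ (a + b) * (A + B) := by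
  have h3 : dist p q * dist q r ≤ (a * B + b * A) / 2 := by
    refine abs_le_of_sq_le_sq' ?_ (by positivity) |>.2
    calc (dist p q * dist q r) ^ 2 = dist p q ^ 2 * dist q r ^ 2 := by ring
      _ ≤ (a * A) * (b * B) := by gcongr
      _ ≤ _ := by nlinarith [sq_nonneg (a * B - b * A)]
  have h4 : dist p r ^ 2 ≤ (dist p q + dist q r) ^ 2 := by
    gcongr
    exact dist_triangle _ _ _
  nlinarith

/-- The function controlling the energy of the regularized curve. -/
def regularizedEnergy (lam ε : ℝ) (G F : ℝ → ℝ) (t : ℝ) : ℝ :=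
  Real.exp (4 * (|lam| * ε)) * (Real.exp (2 * (|lam| * ε)) * G t +
    2 * ε * (if t ≤ 1 / 2 then F (1 / 2) - F t else F t - F (1 / 2)))

theorem energy_regularizedCurve_ne_top (hS : ∀ z, S z 0 = z ∧ IsRegularFlow E lam (S z))
    {γ : Curve X} (h0 : E (γ 0) ≠ ⊤) (h1 : E (γ 1) ≠ ⊤) {ε : ℝ} (hε : 0 < ε) {t : ℝ}
    (ht : t ∈ Set.Icc (0 : ℝ) 1) : E (curveExtend (regularizedCurve hS γ ε) t) ≠ ⊤ := by
  rw [curveExtend_regularizedCurve hS γ hε ht]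
  rcases ht.1.eq_or_lt with rfl | ht0
  · rw [curveExtend_of_mem _ ht]
    simpa [(hS _).1] using h0
  rcases ht.2.eq_or_lt with rfl | ht1
  · rw [curveExtend_of_mem _ ht]
    simpa [(hS _).1] using h1
  exact (hS _).2.ne_top _ (mul_pos hε (lt_min ht0 (sub_pos.2 ht1)))

/-- On each half of `[0, 1]` the flow time is affine with slope `±ε`, so the two points have evolved
for times differing by `ε * (t - s)`. Descent matters only at the longer-evolved one; requiring it
at both treats the two halves uniformly. -/
theorem regularizedCurve_dist_sq_add_le (hE : IsAdmissible E)
    (hS : ∀ z, S z 0 = z ∧ IsRegularFlow E lam (S z)) {γ : Curve X} (h0 : E (γ 0) ≠ ⊤)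
    (h1 : E (γ 1) ≠ ⊤) {G : ℝ → ℝ} (hG : IsEnergyBound (curveExtend γ) G) {ε : ℝ} (hε : 0 < ε)
    {s t q : ℝ} (hs : 0 ≤ s) (hst : s ≤ t) (ht : t ≤ 1) (hhalf : t ≤ 1 / 2 ∨ 1 / 2 ≤ s)
    (hq : 0 ≤ q) (hdesc : q = 0 ∨
      HasDescent E lam (curveExtend (regularizedCurve hS γ ε) s) q ∧
      HasDescent E lam (curveExtend (regularizedCurve hS γ ε) t) q) :
    dist (curveExtend (regularizedCurve hS γ ε) s) (curveExtend (regularizedCurve hS γ ε) t) ^ 2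
        + ε ^ 2 * q ^ 2 * (t - s) ^ 2 ≤
      (t - s) * (regularizedEnergy lam ε G
          (fun r => (E (curveExtend (regularizedCurve hS γ ε) r)).toReal) t -
        regularizedEnergy lam ε G
          (fun r => (E (curveExtend (regularizedCurve hS γ ε) r)).toReal) s) := by
  have hs' : s ∈ Set.Icc (0 : ℝ) 1 := ⟨hs, hst.trans ht⟩
  have ht' : t ∈ Set.Icc (0 : ℝ) 1 := ⟨hs.trans hst, ht⟩
  have hfs := energy_regularizedCurve_ne_top hS h0 h1 hε hs'
  have hft := energy_regularizedCurve_ne_top hS h0 h1 hε ht'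
  set T := curveExtend (regularizedCurve hS γ ε) with hT
  have hTs : T s = _ := curveExtend_regularizedCurve hS γ hε hs'
  have hTt : T t = _ := curveExtend_regularizedCurve hS γ hε ht'
  have hd := hG.sq_le s t hs hst ht
  have hΔ : 0 ≤ t - s := sub_nonneg.2 hst
  rcases hhalf with hhalf | hhalf
  · rw [min_eq_left (by linarith)] at hTs hTt
    have hadd : ε * s + ε * (t - s) = ε * t := by ring
    have key := dist_flow_sq_add_le hE hS (z := curveExtend γ s) (z' := curveExtend γ t) (ε := ε)
      (h := ε * s) (Δ := t - s) hε (by positivity) hΔ (by rw [hadd]; nlinarith) hd hq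
      (by rw [hadd, ← hTt]; exact hdesc.imp_right And.right) (by rwa [← hTs])
    rw [hadd, ← hTs, ← hTt] at key
    refine key.trans (le_of_eq ?_)
    simp only [regularizedEnergy, if_pos hhalf, if_pos (hst.trans hhalf)]
    ring
  · have ht2 : 1 / 2 ≤ t := hhalf.trans hst
    rw [min_eq_right (by linarith)] at hTs hTt
    have hadd : ε * (1 - t) + ε * (t - s) = ε * (1 - s) := by ring
    -- On the right half the flow time decreases, so `s` and `t` exchange roles and the energy
    -- difference changes sign; hence the case split in `regularizedEnergy`.
    have key := dist_flow_sq_add_le hE hS (z := curveExtend γ t) (z' := curveExtend γ s) (ε := ε)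
      (h := ε * (1 - t)) (Δ := t - s) hε (mul_nonneg hε.le (by linarith)) hΔ
      (by rw [hadd]; nlinarith) (by rwa [dist_comm]) hq
      (by rw [hadd, ← hTs]; exact hdesc.imp_right And.left) (by rwa [← hTt])
    rw [hadd, ← hTs, ← hTt, dist_comm] at key
    have hif : ∀ r, 1 / 2 ≤ r → (if r ≤ 1 / 2 then (E (T (1 / 2))).toReal - (E (T r)).toReal else
        (E (T r)).toReal - (E (T (1 / 2))).toReal) =
        (E (T r)).toReal - (E (T (1 / 2))).toReal := by
      intro r hr
      split_ifs with h
      · rw [le_antisymm h hr]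
      · rfl
    refine key.trans (le_of_eq ?_)
    simp only [regularizedEnergy, hif s hhalf, hif t ht2]
    ring

theorem isEnergyBound_regularizedCurve (hE : IsAdmissible E)
    (hS : ∀ z, S z 0 = z ∧ IsRegularFlow E lam (S z)) {γ : Curve X} (h0 : E (γ 0) ≠ ⊤)
    (h1 : E (γ 1) ≠ ⊤) {G : ℝ → ℝ} (hG : IsEnergyBound (curveExtend γ) G) {ε : ℝ} (hε : 0 < ε) :
    IsEnergyBound (curveExtend (regularizedCurve hS γ ε)) (regularizedEnergy lam ε G
      (fun r => (E (curveExtend (regularizedCurve hS γ ε) r)).toReal)) := by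
  set T := curveExtend (regularizedCurve hS γ ε)
  set w := regularizedEnergy lam ε G fun r => (E (T r)).toReal
  have key : ∀ s t, 0 ≤ s → s ≤ t → t ≤ 1 → (t ≤ 1 / 2 ∨ 1 / 2 ≤ s) →
      dist (T s) (T t) ^ 2 ≤ (t - s) * (w t - w s) := by
    intro s t hs hst ht hhalf
    have := regularizedCurve_dist_sq_add_le hE hS h0 h1 hG hε hs hst ht hhalf le_rfl (Or.inl rfl)
    simpa using this
  have hmono' : ∀ s t, 0 ≤ s → s ≤ t → t ≤ 1 → (t ≤ 1 / 2 ∨ 1 / 2 ≤ s) → w s ≤ w t := by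
    intro s t hs hst ht hhalf
    rcases hst.eq_or_lt with rfl | hst
    · exact le_rfl
    have h := (sq_nonneg _).trans (key s t hs hst.le ht hhalf)
    exact sub_nonneg.1 (nonneg_of_mul_nonneg_right h (sub_pos.2 hst))
  refine ⟨fun s hs t ht hst => ?_, fun s t hs hst ht => ?_⟩
  · rcases le_total t (1 / 2) with h | h
    · exact hmono' s t hs.1 hst ht.2 (Or.inl h)
    rcases le_total s (1 / 2) with h' | h'
    · exact (hmono' s (1 / 2) hs.1 h' (by norm_num) (Or.inl le_rfl)).trans
        (hmono' (1 / 2) t (by norm_num) h ht.2 (Or.inr le_rfl))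
    · exact hmono' s t hs.1 hst ht.2 (Or.inr h')
  · rcases le_total t (1 / 2) with h | h
    · exact key s t hs hst ht (Or.inl h)
    rcases le_total s (1 / 2) with h' | h'
    -- Intervals across `1 / 2` are cut there, and the two displacement bounds are combined by
    -- Cauchy–Schwarz.
    · have := dist_sq_le_of_dist_sq_le (sub_nonneg.2 h') (sub_nonneg.2 h)
        (sub_nonneg.2 (hmono' s (1 / 2) hs h' (by norm_num) (Or.inl le_rfl)))
        (sub_nonneg.2 (hmono' (1 / 2) t (by norm_num) h ht (Or.inr le_rfl)))
        (key s (1 / 2) hs h' (by norm_num) (Or.inl le_rfl))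
        (key (1 / 2) t (by norm_num) h ht (Or.inr le_rfl))
      refine this.trans (le_of_eq ?_)
      ring
    · exact key s t hs hst ht (Or.inr h')

theorem add_mul_sq_le_of_forall_lt {a b M m : ℝ≥0∞} (hb : b ≠ ⊤) (h0 : a ≤ M)
    (h : ∀ q : ℝ, 0 ≤ q → ENNReal.ofReal q < m → a + b * ENNReal.ofReal q ^ 2 ≤ M) :
    a + b * m ^ 2 ≤ M := by
  rcases eq_or_ne m 0 with rfl | hm
  · simpa using h0
  have : (𝓝[<] m).NeBot := nhdsLT_neBot_of_exists_lt ⟨0, pos_iff_ne_zero.2 hm⟩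
  have hc : Continuous fun q : ℝ≥0∞ => a + b * q ^ 2 :=
    continuous_const.add ((ENNReal.continuous_const_mul hb).comp (ENNReal.continuous_pow 2))
  refine le_of_tendsto (x := 𝓝[<] m) ((hc.tendsto m).mono_left nhdsWithin_le_nhds) ?_
  filter_upwards [self_mem_nhdsWithin] with q hq
  have hq : q < m := hq
  have hqt : ENNReal.ofReal q.toReal = q := ENNReal.ofReal_toReal hq.ne_top
  have := h q.toReal ENNReal.toReal_nonneg (by rwa [hqt])
  rwa [hqt] at this

/-- For each `q` below the slope at time `t`, descent of rate `q` persists along the curve near `t`,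
so the increment estimate with the extra `ε² q² (t - s)²` can be differentiated; then `q` increases
to the slope. -/
theorem metricSpeed_sq_add_metricSlope_sq_le (hE : IsAdmissible E)
    (hS : ∀ z, S z 0 = z ∧ IsRegularFlow E lam (S z)) {γ : Curve X} (h0 : E (γ 0) ≠ ⊤)
    (h1 : E (γ 1) ≠ ⊤) {G : ℝ → ℝ} (hG : IsEnergyBound (curveExtend γ) G) {ε : ℝ} (hε : 0 < ε)
    {t : ℝ} (ht : t ∈ Set.Ioo (0 : ℝ) 1) (hhalf : t ≠ 1 / 2)
    (hd : DifferentiableAt ℝ (regularizedEnergy lam ε G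
      (fun r => (E (curveExtend (regularizedCurve hS γ ε) r)).toReal)) t) :
    metricSpeed (curveExtend (regularizedCurve hS γ ε)) t ^ 2 +
        ENNReal.ofReal (ε ^ 2) * metricSlope E (curveExtend (regularizedCurve hS γ ε) t) ^ 2 ≤
      ENNReal.ofReal (deriv (regularizedEnergy lam ε G
        (fun r => (E (curveExtend (regularizedCurve hS γ ε) r)).toReal)) t) := by
  set T := curveExtend (regularizedCurve hS γ ε) with hT
  set w := regularizedEnergy lam ε G fun r => (E (T r)).toReal with hw
  have hside : ∀ᶠ s in 𝓝 t, s ∈ Set.Ioo (0 : ℝ) 1 ∧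
      (s ≤ 1 / 2 ∧ t ≤ 1 / 2 ∨ 1 / 2 ≤ s ∧ 1 / 2 ≤ t) := by
    rcases lt_or_gt_of_ne hhalf with h | h
    · filter_upwards [Ioo_mem_nhds ht.1 ht.2, Iio_mem_nhds h] with s hs hs'
      exact ⟨hs, Or.inl ⟨le_of_lt hs', h.le⟩⟩
    · filter_upwards [Ioo_mem_nhds ht.1 ht.2, Ioi_mem_nhds h] with s hs hs'
      exact ⟨hs, Or.inr ⟨le_of_lt hs', h.le⟩⟩
  have main : ∀ q, 0 ≤ q → (q = 0 ∨ HasDescent E lam (T t) q) →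
      metricSpeed T t ^ 2 + ENNReal.ofReal (ε ^ 2 * q ^ 2) ≤ ENNReal.ofReal (deriv w t) := by
    intro q hq hdesc
    refine metricSpeed_sq_add_le (by positivity) hd (nhdsWithin_le_nhds ?_)
    have hev : ∀ᶠ s in 𝓝 t, q = 0 ∨ HasDescent E lam (T s) q := by
      rcases hdesc with h | h
      · exact Eventually.of_forall fun _ => Or.inl h
      · exact ((continuous_curveExtend _).continuousAt.eventually (h.eventually hE)).mono
          fun _ => Or.inr
    filter_upwards [hside, hev] with s hs hs'
    obtain ⟨hs, hhalf⟩ := hs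
    have hboth : q = 0 ∨ HasDescent E lam (T s) q ∧ HasDescent E lam (T t) q := by tauto
    rcases le_total s t with hst | hst
    · have := regularizedCurve_dist_sq_add_le hE hS h0 h1 hG hε hs.1.le hst ht.2.le (by tauto) hq
        hboth
      refine le_trans (le_of_eq ?_) (this.trans (le_of_eq ?_)) <;> ring
    · have := regularizedCurve_dist_sq_add_le hE hS h0 h1 hG hε ht.1.le hst hs.2.le (by tauto) hq
        (hboth.imp_right And.symm)
      rwa [dist_comm] at this
  refine add_mul_sq_le_of_forall_lt ENNReal.ofReal_ne_top ?_ fun q hq hlt => ?_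
  · simpa using main 0 le_rfl (Or.inl rfl)
  · rw [← ENNReal.ofReal_pow hq, ← ENNReal.ofReal_mul (sq_nonneg ε)]
    exact main q hq (Or.inr (hasDescent_of_lt_metricSlope hE lam
      (energy_regularizedCurve_ne_top hS h0 h1 hε (Set.Ioo_subset_Icc_self ht)) hq hlt))

theorem schrodingerAction_regularizedCurve_le (hE : IsAdmissible E)
    (hS : ∀ z, S z 0 = z ∧ IsRegularFlow E lam (S z)) {γ : Curve X} (h0 : E (γ 0) ≠ ⊤)
    (h1 : E (γ 1) ≠ ⊤) {G : ℝ → ℝ} (hG : IsEnergyBound (curveExtend γ) G) {ε : ℝ} (hε : 0 < ε) :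
    schrodingerAction E ε (regularizedCurve hS γ ε) ≤ 1 / 2 * ENNReal.ofReal
      (Real.exp (4 * (|lam| * ε)) * (Real.exp (2 * (|lam| * ε)) * (G 1 - G 0) +
        2 * ε * ((E (γ 0)).toReal + (E (γ 1)).toReal -
          2 * (E (regularizedCurve hS γ ε ⟨1 / 2, by norm_num, by norm_num⟩)).toReal))) := by
  have hb := isEnergyBound_regularizedCurve hE hS h0 h1 hG hε
  have hint := lintegral_le_of_le_deriv zero_le_one hb.mono
    (g := fun t => metricSpeed (curveExtend (regularizedCurve hS γ ε)) t ^ 2 +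
        ENNReal.ofReal (ε ^ 2) * metricSlope E (curveExtend (regularizedCurve hS γ ε) t) ^ 2) (by
      have hne : ∀ᵐ t : ℝ, t ≠ 1 / 2 := by simp [ae_iff]
      filter_upwards [hne] with t hne ht hd
      exact metricSpeed_sq_add_metricSlope_sq_le hE hS h0 h1 hG hε ht hne hd)
  have hends : ∀ (t : ℝ) (ht : t ∈ Set.Icc (0 : ℝ) 1), min t (1 - t) = 0 →
      curveExtend (regularizedCurve hS γ ε) t = γ ⟨t, ht⟩ := by
    intro t ht h
    rw [curveExtend_regularizedCurve hS γ hε ht, h, mul_zero, (hS _).1, curveExtend_of_mem _ ht]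
  rw [schrodingerAction, kineticAction, if_pos hb.absolutelyContinuousOnInterval, fisherInformation,
    mul_left_comm, ← mul_add]
  gcongr 1 / 2 * ?_
  rw [← lintegral_const_mul' _ _ ENNReal.ofReal_ne_top]
  -- The lower integral is superadditive without measurability, which is the direction needed here.
  refine (le_lintegral_add _ _).trans (hint.trans (ENNReal.ofReal_le_ofReal (le_of_eq ?_)))
  have e0 : curveExtend (regularizedCurve hS γ ε) 0 = γ 0 :=
    hends 0 ⟨le_rfl, zero_le_one⟩ (by simp)
  have e1 : curveExtend (regularizedCurve hS γ ε) 1 = γ 1 :=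
    hends 1 ⟨zero_le_one, le_rfl⟩ (by simp)
  have e2 : curveExtend (regularizedCurve hS γ ε) (1 / 2) =
      regularizedCurve hS γ ε ⟨1 / 2, by norm_num, by norm_num⟩ := curveExtend_of_mem _ _
  simp only [regularizedEnergy, e0, e1, e2]
  norm_num
  ring

/-! ### Recovery families -/

/-- The recovery family for a curve of finite action. -/
theorem exists_recovery {E : X → EReal} (hE : IsAdmissible E) {γ : Curve X}
    (h0 : E (γ 0) ≠ ⊤) (h1 : E (γ 1) ≠ ⊤) (hA : kineticAction γ ≠ ⊤) :
    ∃ γs : ℝ → Curve X, Tendsto γs (𝓝[>] 0) (𝓝 γ) ∧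
      (∀ ε > 0, γs ε 0 = γ 0 ∧ γs ε 1 = γ 1) ∧
      limsup (fun ε => schrodingerAction E ε (γs ε)) (𝓝[>] 0) ≤ kineticAction γ := by
  obtain ⟨lam, S, hS⟩ := hE.exists_isRegularFlow h0
  obtain ⟨G, hG, hG0, hG1⟩ := exists_isEnergyBound hA
  have hlim : Tendsto (regularizedCurve hS γ) (𝓝[>] 0) (𝓝 γ) := by
    have := (regularizedCurve hS γ).continuous.tendsto 0
    rw [regularizedCurve_zero] at this
    exact this.mono_left nhdsWithin_le_nhds
  refine ⟨regularizedCurve hS γ, hlim, fun ε _ => ?_, ?_⟩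
  · constructor <;> simp [regularizedCurve, (hS _).1]
  set p : unitInterval := ⟨1 / 2, by norm_num, by norm_num⟩ with hp
  -- The midpoint energy is the only energy depending on `ε`, and it enters with a minus sign; a
  -- lower bound near `γ p` is enough.
  obtain ⟨c, hc⟩ := hE.bddBelow (Metric.ball (γ p) 1) Metric.isBounded_ball
  have hev : ∀ᶠ ε in 𝓝[>] (0 : ℝ), (c : EReal) ≤ E (regularizedCurve hS γ ε p) := by
    have hp' := ((continuous_eval_const p).tendsto γ).comp hlim
    filter_upwards [hp' (Metric.ball_mem_nhds _ one_pos)] with ε hε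
    exact hc _ hε
  have hbound : Tendsto (fun ε : ℝ => 1 / 2 * ENNReal.ofReal
      (Real.exp (4 * (|lam| * ε)) * (Real.exp (2 * (|lam| * ε)) * (G 1 - G 0) +
        2 * ε * ((E (γ 0)).toReal + (E (γ 1)).toReal - 2 * c)))) (𝓝[>] 0) (𝓝 (kineticAction γ)) := by
    have h2 : Continuous fun ε : ℝ => Real.exp (4 * (|lam| * ε)) *
        (Real.exp (2 * (|lam| * ε)) * (G 1 - G 0) +
        2 * ε * ((E (γ 0)).toReal + (E (γ 1)).toReal - 2 * c)) := by fun_prop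
    have h3 := ENNReal.Tendsto.const_mul (a := 1 / 2) (ENNReal.tendsto_ofReal (h2.tendsto 0))
      (Or.inr (by simp))
    have h4 : 1 / 2 * ENNReal.ofReal (Real.exp (4 * (|lam| * 0)) *
        (Real.exp (2 * (|lam| * 0)) * (G 1 - G 0) +
        2 * 0 * ((E (γ 0)).toReal + (E (γ 1)).toReal - 2 * c))) = kineticAction γ := by
      rw [hG0, hG1]
      simp only [mul_zero, Real.exp_zero, one_mul, sub_zero, zero_mul, add_zero]
      rw [ENNReal.ofReal_mul two_pos.le, ENNReal.ofReal_toReal hA, ← mul_assoc]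
      simp [ENNReal.inv_mul_cancel]
    rw [h4] at h3
    exact h3.mono_left nhdsWithin_le_nhds
  rw [← hbound.limsup_eq]
  refine limsup_le_limsup ?_
  filter_upwards [hev, self_mem_nhdsWithin] with ε hcε hε
  have hε : 0 < ε := hε
  refine (schrodingerAction_regularizedCurve_le hE hS h0 h1 hG hε).trans ?_
  have hfin := energy_regularizedCurve_ne_top hS h0 h1 hε p.2
  rw [curveExtend_of_mem _ p.2] at hfin
  have hcε' : c ≤ (E (regularizedCurve hS γ ε p)).toReal := by
    rw [← hE.coe_toReal hfin] at hcε
    exact_mod_cast hcε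
  gcongr

theorem exists_recovery_endpoints {E : X → EReal} (hE : IsAdmissible E) {x y : X} (hx : E x < ⊤)
    (hy : E y < ⊤) (γ : Curve X) : ∃ γs : ℝ → Curve X, Tendsto γs (𝓝[>] 0) (𝓝 γ) ∧
      limsup (fun ε => schrodingerAction E ε (γs ε) + endpointIndicator x y (γs ε)) (𝓝[>] 0) ≤
        kineticAction γ + endpointIndicator x y γ := by
  by_cases hfin : kineticAction γ + endpointIndicator x y γ = ⊤
  · exact ⟨fun _ => γ, tendsto_const_nhds, by rw [hfin]; exact le_top⟩
  obtain ⟨hA, hι⟩ := ENNReal.add_ne_top.1 hfin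
  have hend : γ 0 = x ∧ γ 1 = y := by
    by_contra h
    exact hι (if_neg h)
  obtain ⟨γs, hlim, hends, hle⟩ := exists_recovery hE (γ := γ) (by rw [hend.1]; exact hx.ne)
    (by rw [hend.2]; exact hy.ne) hA
  refine ⟨γs, hlim, le_trans (le_of_eq (limsup_congr ?_)) (hle.trans le_self_add)⟩
  filter_upwards [self_mem_nhdsWithin] with ε hε
  have h := hends ε hε
  rw [endpointIndicator, if_pos ⟨h.1.trans hend.1, h.2.trans hend.2⟩, add_zero]

end SchrodingerGamma
end

theorem theorem4p3 {X : Type*} [MetricSpace X] [CompleteSpace X]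
    [TopologicalSpace.SeparableSpace X] (E : X → EReal) (hE : SchrodingerGamma.IsAdmissible E)
    (x y : X) (hx : E x < ⊤) (hy : E y < ⊤) :
    SchrodingerGamma.GammaConverges (SchrodingerGamma.uniformTopology X)
        (fun ε γ => SchrodingerGamma.schrodingerAction E ε γ
          + SchrodingerGamma.endpointIndicator x y γ)
        (fun γ => SchrodingerGamma.kineticAction γ
          + SchrodingerGamma.endpointIndicator x y γ) ∧
      ∀ σ : TopologicalSpace X, SchrodingerGamma.IsCompatible E σ →
        SchrodingerGamma.GammaConverges (SchrodingerGamma.pointwiseTopology σ)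
          (fun ε γ => SchrodingerGamma.schrodingerAction E ε γ
            + SchrodingerGamma.endpointIndicator x y γ)
          (fun γ => SchrodingerGamma.kineticAction γ
            + SchrodingerGamma.endpointIndicator x y γ) := by
  have hrec := SchrodingerGamma.exists_recovery_endpoints hE hx hy
  have hpt : ∀ (γs : ℝ → SchrodingerGamma.Curve X) (γ : SchrodingerGamma.Curve X), Tendsto γs (𝓝[>] 0) (𝓝 γ) → ∀ t,
      Tendsto (fun ε => γs ε t) (𝓝[>] 0) (𝓝 (γ t)) := fun γs γ h t =>
    ((continuous_eval_const t).tendsto γ).comp h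
  refine ⟨⟨fun ε γs γ _ _ hγ => SchrodingerGamma.action_le_liminf_uniform E x y ε γs γ hγ, hrec⟩, fun σ hσ =>
    ⟨fun ε γs γ _ _ hγ => SchrodingerGamma.action_le_liminf_pointwise E x y hσ ε γs γ hγ, fun γ => ?_⟩⟩
  obtain ⟨γs, hlim, hle⟩ := hrec γ
  refine ⟨γs, ?_, hle⟩
  rw [SchrodingerGamma.tendsto_pointwiseTopology_iff]
  exact fun t => SchrodingerGamma.tendsto_of_isCompatible (hpt γs γ hlim t) hσ
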